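/- \textbf{Setting.} Let $0<p<1$, $q=1-p$, $Q=1/q$, $L=\ln Q$, $\log=\log_Q$, $\chi_l=2l\pi\mathbf{i}/L$ ($l\in\mathbb Z$), and let $b\ge 0$ be an integer. Every key is hashed to an infinite bit string; all bits of all keys are independent, each being $1$ with probability $p$ and $0$ with probability $q$. Asymmetric adaptive sampling with a cache of capacity $b$ starts with an empty cache and depth $d=0$ and reads a stream in which exactly $n$ distinct keys occur (possibly with repetitions). A key that is read and whose hash value starts with $0^d$ is put into the cache, unless it is already there; as long as the cache holds more than $b$ keys, $d$ is increased by $1$ and the keys whose hash value does not start with $0^d$ are removed. Let $D$ be the final depth and $R$ the final cache size, and write $\mathbb E(Y;R=k)=\mathbb E(Y\mathbf 1_{R=k})$. For $0\le k\le b$ let \[ f(k,\eta)=\exp(-e^{-L\eta})\frac{e^{-Lk\eta}}{k!}\Big[1-\exp\big(-e^{-L\eta}\tfrac pq\big)\sum_{i=0}^{b-k}\frac{e^{-Li\eta}(p/q)^i}{i!}\Big],\qquad \phi(k,\alpha)=\int_{-\infty}^{\infty}e^{\alpha\eta}f(k,\eta)\,d\eta , \] and, with derivatives taken in $\alpha$,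 \[ \tilde m_{j,k}=\phi^{(j)}(k,0),\qquad \tilde w_{j,k}=\tilde w_{j,k}(n)=\sum_{l\ne 0}\phi^{(j)}(k,-L\chi_l)\,e^{-2l\pi\mathbf{i}\log n}. \] \textbf{Theorem.} All moments of $D-\log n$ exist, the series $\tilde w_{j,k}$ converge absolutely (also with $\log n$ replaced by any real number), and there is $\beta>0$ such that for every $j\ge1$ and every $0\le k\le b$, as $n\to\infty$, \[ \mathbb E\big[(D-\log n)^j;R=k\big]=\tilde m_{j,k}+\tilde w_{j,k}(n)+O(n^{-\beta}),\qquad \mathbb E\big[(D-\log n)^j\big]=\sum_{k=0}^b\big(\tilde m_{j,k}+\tilde w_{j,k}(n)\big)+O(n^{-\beta}). \] Moreover, with $\psi$ the digamma function, $\psi(1,\cdot)=\psi'$ and $\gamma$ Euler's constant, for $1\le k\le b$, \begin{align*} \tilde m_{1,k}&=-\frac{\psi(k)}{L^2k}+\sum_{i=0}^{b-k}\frac{(\psi(k+i)-L)\,q^kp^i\,\Gamma(k+i)}{L^2\Gamma(k+1)\Gamma(i+1)},\\ \tilde m_{1,0}&=\frac12+\frac{\gamma}{L}+\sum_{i=1}^{b}\frac{(\psi(i)-L)p^i}{iL^2},\\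 \tilde m_{2,k}&=\frac{\psi(1,k)+\psi(k)^2}{L^3k}-\sum_{i=0}^{b-k}\frac{\big(-2\psi(k+i)L+L^2+\psi(1,k+i)+\psi(k+i)^2\big)q^kp^i\,\Gamma(k+i)}{L^3\Gamma(k+1)\Gamma(i+1)},\\ \tilde m_{2,0}&=\frac13+\frac{\gamma}{L}+\frac{\pi^2}{6L^2}+\frac{\gamma^2}{L^2}-\sum_{i=1}^{b}\frac{\big(-2\psi(i)L+L^2+\psi(1,i)+\psi(i)^2\big)p^i}{iL^3},\\ \tilde w_{1,k}&=\sum_{l\ne0}\Big[-\frac{\psi(k+\chi_l)\Gamma(k+\chi_l)}{L^2\Gamma(k+1)}+\sum_{i=0}^{b-k}\frac{(\psi(k+i+\chi_l)-L)\Gamma(k+i+\chi_l)\,q^{k}p^i}{L^2\Gamma(k+1)\Gamma(i+1)}\Big]e^{-2l\pi\mathbf{i}\log n},\\ \tilde w_{1,0}&=\sum_{l\ne0}\Big[-\frac{\psi(\chi_l)\Gamma(\chi_l)}{L^2}+\sum_{i=0}^{b}\frac{(\psi(i+\chi_l)-L)\Gamma(i+\chi_l)\,p^{i}}{L^2\Gamma(i+1)}\Big]e^{-2l\pi\mathbf{i}\log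 n}, \end{align*} where the last two series hold, with absolute convergence, also with $\log n$ replaced by any real number. -/

import Mathlib

open MeasureTheory ProbabilityTheory Filter Asymptotics

noncomputable section

namespace AdaptiveSampling

/-! ### The algorithm

Keys are identified by natural numbers; `h x m` is the `m`-th bit of the (infinite) hash value of
the key `x`, with `true` standing for the bit `1` and `false` for the bit `0`. -/

/-- The hash value of the key `x` starts with `0^d`. -/
abbrev StartsWithZeros (h : ℕ → ℕ → Bool) (d : ℕ) (x : ℕ) : Prop :=
  ∀ m < d, h x m = false

/-- The data kept by the algorithm: the current depth and the current cache. -/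
structure State where
  depth : ℕ
  cache : Finset ℕ

/-- The initial state: depth `0`, empty cache. -/
def State.init : State := ⟨0, ∅⟩

/-- One filtering of the cache: the depth `d` is replaced by `d + 1`, and the keys whose hash value
does not start with `0^(d+1)` are removed. -/
def filterOnce (h : ℕ → ℕ → Bool) (s : State) : State :=
  ⟨s.depth + 1, s.cache.filter (StartsWithZeros h (s.depth + 1))⟩

/-- Overflow handling: filter the cache as long as it holds more than `b` keys. (If the cache would
overflow for ever, which needs several keys with the hash value `000…` and has probability zero,
nothing is done.) -/
def resolveOverflow (b : ℕ) (h : ℕ → ℕ → Bool) (s : State) : State :=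
  (filterOnce h)^[sInf {j : ℕ | ((filterOnce h)^[j] s).cache.card ≤ b}] s

/-- Treatment of the next element `x` of the stream: if its hash value starts with `0^d`, where
`d` is the current depth, it is put into the cache (unless it is there already), and a
possible overflow is resolved. -/
def step (b : ℕ) (h : ℕ → ℕ → Bool) (s : State) (x : ℕ) : State :=
  if StartsWithZeros h s.depth x then resolveOverflow b h ⟨s.depth, insert x s.cache⟩ else s

/-- The final state of the algorithm with cache capacity `b` on the stream `S`. -/
def run (b : ℕ) (h : ℕ → ℕ → Bool) (S : List ℕ) : State :=
  S.foldl (step b h) State.init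

/-- The final depth. -/
def finalDepth (b : ℕ) (h : ℕ → ℕ → Bool) (S : List ℕ) : ℕ := (run b h S).depth

/-- The final cache size. -/
def finalSize (b : ℕ) (h : ℕ → ℕ → Bool) (S : List ℕ) : ℕ := (run b h S).cache.card

/-! ### The limiting functions

`p` is the probability of the bit `1` and `q = 1 - p` that of the bit `0`. -/

/-- `Q = 1/q`. -/
def Q (p : ℝ) : ℝ := 1 / (1 - p)

/-- `L = ln Q`. -/
def L (p : ℝ) : ℝ := Real.log (Q p)

/-- `χ_l = 2 l π i / L`. -/
def χ (p : ℝ) (l : ℤ) : ℂ := 2 * (l : ℂ) * (Real.pi : ℂ) * Complex.I / (L p : ℂ)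

/-- The asymptotic density `f(r, η)`, for `r ≤ b`. -/
def f (p : ℝ) (b r : ℕ) (η : ℝ) : ℝ :=
  Real.exp (-Real.exp (-L p * η)) * (Real.exp (-L p * r * η) / (r.factorial : ℝ)) *
    (1 - Real.exp (-Real.exp (-L p * η) * (p / (1 - p))) *
      ∑ k ∈ Finset.range (b - r + 1),
        Real.exp (-L p * k * η) * (p / (1 - p)) ^ k / (k.factorial : ℝ))

/-- The Laplace transform `φ(r, α) = ∫ e^{α η} f(r, η) dη` over the whole real line. -/
def φ (p : ℝ) (b r : ℕ) (α : ℂ) : ℂ :=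
  ∫ η : ℝ, Complex.exp (α * (η : ℂ)) * (f p b r η : ℂ)

/-- The non-periodic part of the `j`-th moment on `R = r`: `m̃_{j,r} = φ^{(j)}(r, 0)`, the
derivative being taken with respect to `α`. -/
def mTilde (p : ℝ) (b j r : ℕ) : ℂ := iteratedDeriv j (φ p b r) 0

/-- The `l`-th term of the Fourier series of the periodic part of the `j`-th moment on `R = r`:
`φ^{(j)}(r, -L χ_l) e^{-2 l π i x}`. -/
def wTerm (p : ℝ) (b j r : ℕ) (x : ℝ) (l : ℤ) : ℂ :=
  iteratedDeriv j (φ p b r) (-(L p : ℂ) * χ p l) *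
    Complex.exp (-(2 * (l : ℂ) * (Real.pi : ℂ) * Complex.I * (x : ℂ)))

/-- The periodic part `w̃_{j,r}`, as a function of `x = log_Q n`. -/
def wTilde (p : ℝ) (b j r : ℕ) (x : ℝ) : ℂ :=
  ∑' l : {l : ℤ // l ≠ 0}, wTerm p b j r x (l : ℤ)

/-- The trigamma function `ψ(1, s)`, the derivative of the digamma function. -/
def trigamma (s : ℂ) : ℂ := deriv Complex.digamma s

end AdaptiveSampling

end

/-! ### Deterministic analysis of the algorithm. -/

namespace AdaptiveSampling

/-! Almost surely no hash value is identically `0`, and then the final state depends only on the set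
of keys read (`run_eq`): `D` is the least depth at which at most `b` keys survive, and `R` is the
number of survivors there. So `D = d + 1` and `R = k` means that `k` keys have `d + 1` leading zeros
while more than `b` keys have `d` of them. By independence this probability is an explicit
combination of binomial probabilities with success probabilities `q^(d+1)` and `q^d`
(`real_depth_size`).

With `η = d + 1 - log n` the means are `n q^(d+1) = e^(-Lη)` and `n q^d = e^(-Lη)/q`. Replacing each
binomial probability by the Poisson probability of the same mean turns the law into `f(k, η)`, and
the error is at most a constant times `e^(-L|η|)/n` (`exists_abs_law_sub_f_le`). The weight
`e^(-L|η|)` makes this summable against `|η|^j`, uniformly in the position of `log n` modulo `1`.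
Nonpositive depths also contribute only `O(1/n)`. Hence the `j`-th moment on `R = k` is the sum over
all integers `d` of `(d - log n)^j f(k, d - log n)`, up to `O(1/n)`, and `β = 1` works.

The function `η^j f(k, η)` is a Schwartz function, so Poisson summation rewrites that sum as a
Fourier series in `log n` (`hasSum_moment`). Its coefficients are values of the `j`-th derivative of
the Laplace transform `φ(k, ·)` at the points `-L χ_l`: the term `l = 0` is `mTilde` and the rest is
`wTilde`.

For the explicit formulas, `t = e^(-Lη)` turns `φ` into a sum of Gamma functions (`phi_eq_Gamma`),
which is then differentiated. When `k = 0` the poles of two Gamma terms at `0` cancel, leaving the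
entire factor `(e^z - 1)/z`, whose Taylor coefficients produce the rational constants `1/2` and
`1/3`. The value `ψ'(1) = π²/6` comes from the reflection formula (`trigamma_one`). -/

/-- The keys of `T` whose hash value starts with `0^d`. -/
def zeroKeys (h : ℕ → ℕ → Bool) (T : Finset ℕ) (d : ℕ) : Finset ℕ :=
  T.filter (StartsWithZeros h d)

/-- The least depth at which the keys of `T` fit into a cache of capacity `b`. -/
noncomputable def fitDepth (b : ℕ) (h : ℕ → ℕ → Bool) (T : Finset ℕ) : ℕ :=
  sInf {d | (zeroKeys h T d).card ≤ b}

variable {b : ℕ} {h : ℕ → ℕ → Bool}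

lemma startsWithZeros_mono {d e x : ℕ} (hde : d ≤ e) (hx : StartsWithZeros h e x) :
    StartsWithZeros h d x := fun m hm => hx m (hm.trans_le hde)

lemma zeroKeys_anti (T : Finset ℕ) {d e : ℕ} (hde : d ≤ e) : zeroKeys h T e ⊆ zeroKeys h T d := by
  intro x hx
  simp only [zeroKeys, Finset.mem_filter] at hx ⊢
  exact ⟨hx.1, startsWithZeros_mono hde hx.2⟩

lemma zeroKeys_zeroKeys (T : Finset ℕ) {d e : ℕ} (hde : d ≤ e) :
    zeroKeys h (zeroKeys h T d) e = zeroKeys h T e := by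
  ext x
  simp only [zeroKeys, Finset.mem_filter]
  exact ⟨fun hx => ⟨hx.1.1, hx.2⟩, fun hx => ⟨⟨hx.1, startsWithZeros_mono hde hx.2⟩, hx.2⟩⟩

lemma zeroKeys_zero (T : Finset ℕ) : zeroKeys h T 0 = T := by
  simp [zeroKeys, StartsWithZeros]

lemma exists_zeroKeys_eq_empty (hh : ∀ x, ∃ m, h x m = true) (T : Finset ℕ) :
    ∃ d, zeroKeys h T d = ∅ := by
  choose m hm using hh
  refine ⟨T.sup m + 1, ?_⟩
  rw [zeroKeys, Finset.filter_eq_empty_iff]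
  intro x hx hz
  have := hz (m x) (Nat.lt_succ_of_le (Finset.le_sup hx))
  simp [hm] at this

lemma card_zeroKeys_fitDepth (hh : ∀ x, ∃ m, h x m = true) (T : Finset ℕ) :
    (zeroKeys h T (fitDepth b h T)).card ≤ b := by
  have hne : {d | (zeroKeys h T d).card ≤ b}.Nonempty := by
    obtain ⟨d, hd⟩ := exists_zeroKeys_eq_empty hh T
    exact ⟨d, by simp [hd]⟩
  exact Nat.sInf_mem hne

/-- The survivor count decreases with the depth, so the depths that fit form an up-set; `hh` makes
it nonempty, which keeps the infimum from taking its default value. -/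
lemma fitDepth_le_iff (hh : ∀ x, ∃ m, h x m = true) (T : Finset ℕ) (d : ℕ) :
    fitDepth b h T ≤ d ↔ (zeroKeys h T d).card ≤ b :=
  ⟨fun hd => (Finset.card_le_card (zeroKeys_anti T hd)).trans (card_zeroKeys_fitDepth hh T),
    fun hd => Nat.sInf_le hd⟩

lemma filterOnce_iterate (d j : ℕ) (C : Finset ℕ) (hC : zeroKeys h C d = C) :
    (filterOnce h)^[j] ⟨d, C⟩ = ⟨d + j, zeroKeys h C (d + j)⟩ := by
  induction j with
  | zero => simp [hC]
  | succ j ih =>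
    rw [Function.iterate_succ_apply', ih, filterOnce]
    congr 1
    exact zeroKeys_zeroKeys C (Nat.le_succ _)

lemma zeroKeys_insert_of_pos {T : Finset ℕ} {x d : ℕ} (hx : StartsWithZeros h d x) :
    zeroKeys h (insert x T) d = insert x (zeroKeys h T d) := by
  rw [zeroKeys, Finset.filter_insert, if_pos hx, zeroKeys]

lemma zeroKeys_insert_of_neg {T : Finset ℕ} {x d : ℕ} (hx : ¬ StartsWithZeros h d x) :
    zeroKeys h (insert x T) d = zeroKeys h T d := by
  rw [zeroKeys, Finset.filter_insert, if_neg hx, zeroKeys]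

lemma fitDepth_le_insert (hh : ∀ x, ∃ m, h x m = true) (T : Finset ℕ) (x : ℕ) :
    fitDepth b h T ≤ fitDepth b h (insert x T) := by
  rw [fitDepth_le_iff hh]
  exact (Finset.card_le_card (Finset.filter_subset_filter _ (Finset.subset_insert _ _))).trans
    (card_zeroKeys_fitDepth hh (insert x T))

/-- The loop invariant. Keys discarded earlier lack the prefix `0^d`, so they cannot matter at any
later depth; a key without that prefix leaves the count at depth `d` unchanged. -/
lemma step_fitDepth (hh : ∀ x, ∃ m, h x m = true) (T : Finset ℕ) (x : ℕ) :
    step b h ⟨fitDepth b h T, zeroKeys h T (fitDepth b h T)⟩ x =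
      ⟨fitDepth b h (insert x T), zeroKeys h (insert x T) (fitDepth b h (insert x T))⟩ := by
  set d := fitDepth b h T with hd
  rw [step]
  split_ifs with hx
  · have hC : zeroKeys h (insert x (zeroKeys h T d)) d = insert x (zeroKeys h T d) := by
      rw [← zeroKeys_insert_of_pos hx, zeroKeys_zeroKeys _ le_rfl]
    have hit : ∀ j, (filterOnce h)^[j] ⟨d, insert x (zeroKeys h T d)⟩ =
        ⟨d + j, zeroKeys h (insert x T) (d + j)⟩ := by
      intro j
      rw [filterOnce_iterate d j _ hC, ← zeroKeys_insert_of_pos hx,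
        zeroKeys_zeroKeys _ (Nat.le_add_right d j)]
    change resolveOverflow b h ⟨d, insert x (zeroKeys h T d)⟩ = _
    rw [resolveOverflow]
    simp only [hit]
    -- The search starts at `d` instead of `0`, but the new least fitting depth is at least `d`, so
    -- nothing is missed.
    have hj : d + sInf {j | (zeroKeys h (insert x T) (d + j)).card ≤ b} =
        fitDepth b h (insert x T) := by
      obtain ⟨j, hj⟩ := Nat.exists_eq_add_of_le (fitDepth_le_insert (b := b) hh T x)
      rw [← hd] at hj
      rw [hj]
      congr 1
      simp_rw [← fitDepth_le_iff hh, hj]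
      apply le_antisymm
      · exact Nat.sInf_le (by simp)
      · exact le_csInf ⟨j, by simp⟩ (by simp)
    rw [hj]
  · have hd' : fitDepth b h (insert x T) = d := by
      apply le_antisymm _ (fitDepth_le_insert hh T x)
      rw [fitDepth_le_iff hh, zeroKeys_insert_of_neg hx]
      exact card_zeroKeys_fitDepth hh T
    rw [hd', zeroKeys_insert_of_neg hx]

theorem run_eq (hh : ∀ x, ∃ m, h x m = true) (S : List ℕ) :
    run b h S = ⟨fitDepth b h S.toFinset, zeroKeys h S.toFinset (fitDepth b h S.toFinset)⟩ := by
  induction S using List.reverseRecOn with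
  | nil =>
    have : fitDepth b h ∅ = 0 := Nat.le_zero.mp ((fitDepth_le_iff hh _ _).2 (by simp [zeroKeys]))
    simp [run, State.init, this, zeroKeys]
  | append_singleton S x ih =>
    have hins : (S ++ [x]).toFinset = insert x S.toFinset := by ext; simp
    rw [hins, ← step_fitDepth hh, ← ih, run, List.foldl_append, run]
    rfl

lemma finalDepth_eq (hh : ∀ x, ∃ m, h x m = true) (S : List ℕ) :
    finalDepth b h S = fitDepth b h S.toFinset := by rw [finalDepth, run_eq hh]

lemma finalSize_eq (hh : ∀ x, ∃ m, h x m = true) (S : List ℕ) :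
    finalSize b h S = (zeroKeys h S.toFinset (fitDepth b h S.toFinset)).card := by
  rw [finalSize, run_eq hh]

lemma fitDepth_eq_succ_iff (hh : ∀ x, ∃ m, h x m = true) (T : Finset ℕ) (d : ℕ) :
    fitDepth b h T = d + 1 ↔
      (zeroKeys h T (d + 1)).card ≤ b ∧ b < (zeroKeys h T d).card := by
  rw [← fitDepth_le_iff hh, ← not_le, ← fitDepth_le_iff hh]
  omega

end AdaptiveSampling

/-! ### Independence of the hash values of distinct keys. -/

namespace AdaptiveSampling

section Independence

variable {Ω ι κ : Type*} [MeasurableSpace Ω] {P : Measure Ω}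

/-- The rows of an independent array of random variables are independent. -/
lemma iIndepFun_rows {𝓧 : Type*} [MeasurableSpace 𝓧] {X : ι → κ → Ω → 𝓧}
    (mX : ∀ i j, Measurable (X i j))
    (hX : iIndepFun (fun (ij : ι × κ) => X ij.1 ij.2) P) :
    iIndepFun (fun i ω j => X i j ω) P := by
  have := hX.isProbabilityMeasure
  have : ∀ i j, IsProbabilityMeasure (P.map (X i j)) :=
    fun i j => Measure.isProbabilityMeasure_map (mX i j).aemeasurable
  have hrow : ∀ i, iIndepFun (X i) P := fun i =>
    hX.precomp (g := fun j : κ => (i, j)) (fun a b hab => by simpa using hab)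
  -- Reindexing by a sigma type allows currying, which identifies a product measure over pairs with
  -- a product of product measures.
  have hX' : iIndepFun (fun (ij : (_ : ι) × κ) => X ij.1 ij.2) P :=
    hX.precomp (g := Equiv.sigmaEquivProd ι κ) (Equiv.injective _)
  rw [iIndepFun_iff_map_fun_eq_infinitePi_map (by fun_prop)] at hX' ⊢
  have hc : (MeasurableEquiv.piCurry (fun (_ : ι) (_ : κ) => 𝓧)) ∘
      (fun ω (p : (_ : ι) × κ) => X p.1 p.2 ω) = fun ω i j => X i j ω := by
    ext; simp [Sigma.curry]
  have h := congrArg (Measure.map (MeasurableEquiv.piCurry (fun (_ : ι) (_ : κ) => 𝓧))) hX'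
  rw [Measure.map_map (by fun_prop) (by fun_prop), hc,
    Measure.infinitePi_map_piCurry (fun i j => P.map (X i j))] at h
  rw [h]
  congr 1
  ext1 i
  rw [(iIndepFun_iff_map_fun_eq_infinitePi_map (by fun_prop)).1 (hrow i)]

end Independence

/-! ### Probabilities of configurations of leading zeros. -/

section Law

variable {Ω : Type*} [MeasurableSpace Ω] {P : Measure Ω} {bit : ℕ → ℕ → Ω → Bool} {p : ℝ}

/-- The bit sequences starting with `0^d`. -/
def zeroCylinder (d : ℕ) : Set (ℕ → Bool) := {z | ∀ m < d, z m = false}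

lemma measurableSet_zeroCylinder (d : ℕ) : MeasurableSet (zeroCylinder d) := by
  have : zeroCylinder d = ⋂ m ∈ Finset.range d, (fun z : ℕ → Bool => z m) ⁻¹' {false} := by
    ext; simp [zeroCylinder]
  rw [this]
  exact Finset.measurableSet_biInter _ fun m _ => measurable_pi_apply m (measurableSet_singleton _)

lemma zeroCylinder_anti {d e : ℕ} (hde : d ≤ e) : zeroCylinder e ⊆ zeroCylinder d :=
  fun _ hz m hm => hz m (hm.trans_le hde)

lemma real_zeroCylinder [IsProbabilityMeasure P] (hm : ∀ x m, Measurable (bit x m))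
    (hi : iIndepFun (fun xm : ℕ × ℕ => bit xm.1 xm.2) P)
    (hp : ∀ x m, P.real {ω | bit x m ω = true} = p) (x d : ℕ) :
    P.real ((fun ω m => bit x m ω) ⁻¹' zeroCylinder d) = (1 - p) ^ d := by
  have hrow : iIndepFun (bit x) P :=
    hi.precomp (g := fun j : ℕ => (x, j)) (fun a b hab => by simpa using hab)
  have h := hrow.measure_inter_preimage_eq_mul (Finset.range d) (sets := fun _ => {false})
    (fun _ _ => measurableSet_singleton _)
  have hset : (fun ω m => bit x m ω) ⁻¹' zeroCylinder d =
      ⋂ m ∈ Finset.range d, bit x m ⁻¹' {false} := by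
    ext; simp [zeroCylinder]
  rw [hset, measureReal_def, h, ENNReal.toReal_prod]
  have h0 : ∀ m, (P (bit x m ⁻¹' {false})).toReal = 1 - p := by
    intro m
    have : bit x m ⁻¹' {false} = {ω | bit x m ω = true}ᶜ := by ext; simp
    rw [← measureReal_def, this, probReal_compl_eq_one_sub, hp]
    exact hm x m (measurableSet_singleton true)
  simp [h0]

/-- The sets of keys with at least `e` and with at least `d` leading zeros have the values `T` and
`U`. -/
def keyEvent (bit : ℕ → ℕ → Ω → Bool) (n d e : ℕ) (T U : Finset ℕ) : Set Ω :=
  {ω | zeroKeys (fun x m => bit x m ω) (Finset.range n) e = T ∧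
    zeroKeys (fun x m => bit x m ω) (Finset.range n) d = U}

-- Prescribing both survivor sets puts each key into one of three cells (at least `e` zeros, at
-- least `d` but not `e`, fewer than `d`), so the event factors over the keys.
omit [MeasurableSpace Ω] in
lemma keyEvent_eq {n d e : ℕ} (hde : d ≤ e) {T U : Finset ℕ} (hTU : T ⊆ U)
    (hU : U ⊆ Finset.range n) :
    keyEvent bit n d e T U = ⋂ x ∈ Finset.range n, (fun ω m => bit x m ω) ⁻¹'
      (if x ∈ T then zeroCylinder e else
        if x ∈ U then zeroCylinder d \ zeroCylinder e else (zeroCylinder d)ᶜ) := by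
  ext ω
  simp only [keyEvent, zeroKeys, Set.mem_ofPred_eq, Set.mem_iInter, Set.mem_preimage,
    Finset.ext_iff, Finset.mem_filter]
  have hz : ∀ x c, StartsWithZeros (fun x m => bit x m ω) c x ↔
      (fun m => bit x m ω) ∈ zeroCylinder c := fun x c => Iff.rfl
  simp only [hz]
  constructor
  · rintro ⟨h1, h2⟩ x hx
    specialize h1 x; specialize h2 x
    split_ifs with hT hU'
    · exact (h1.2 hT).2
    · exact ⟨(h2.2 hU').2, fun h => hT (h1.1 ⟨hx, h⟩)⟩
    · exact fun h => hU' (h2.1 ⟨hx, h⟩)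
  · intro h
    refine ⟨fun x => ⟨fun ⟨hx, hxe⟩ => ?_, fun hT => ?_⟩,
      fun x => ⟨fun ⟨hx, hxd⟩ => ?_, fun hU' => ?_⟩⟩
    · have := h x hx
      by_contra hT
      rw [if_neg hT] at this
      split_ifs at this with hU'
      · exact this.2 hxe
      · exact this (zeroCylinder_anti hde hxe)
    · have hx := hU (hTU hT)
      have := h x hx
      rw [if_pos hT] at this
      exact ⟨hx, this⟩
    · have := h x hx
      by_contra hU'
      rw [if_neg (fun hT => hU' (hTU hT)), if_neg hU'] at this
      exact this hxd
    · have hx := hU hU'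
      have := h x hx
      refine ⟨hx, ?_⟩
      split_ifs at this with hT
      · exact zeroCylinder_anti hde this
      · exact this.1

lemma measurableSet_cell (d e : ℕ) (T U : Finset ℕ) (x : ℕ) : MeasurableSet
      (if x ∈ T then zeroCylinder e else
        if x ∈ U then zeroCylinder d \ zeroCylinder e else (zeroCylinder d)ᶜ) := by
  split_ifs
  · exact measurableSet_zeroCylinder e
  · exact (measurableSet_zeroCylinder d).diff (measurableSet_zeroCylinder e)
  · exact (measurableSet_zeroCylinder d).compl

lemma measurableSet_keyEvent (hm : ∀ x m, Measurable (bit x m)) {n d e : ℕ} (hde : d ≤ e)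
    {T U : Finset ℕ} (hTU : T ⊆ U) (hU : U ⊆ Finset.range n) :
    MeasurableSet (keyEvent bit n d e T U) := by
  rw [keyEvent_eq hde hTU hU]
  exact Finset.measurableSet_biInter _ fun x _ =>
    (measurable_pi_lambda _ fun m => hm x m) (measurableSet_cell d e T U x)

lemma real_keyEvent [IsProbabilityMeasure P] (hm : ∀ x m, Measurable (bit x m))
    (hi : iIndepFun (fun xm : ℕ × ℕ => bit xm.1 xm.2) P)
    (hp : ∀ x m, P.real {ω | bit x m ω = true} = p) {n d e : ℕ} (hde : d ≤ e)
    {T U : Finset ℕ} (hTU : T ⊆ U) (hU : U ⊆ Finset.range n) :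
    P.real (keyEvent bit n d e T U) =
      ((1 - p) ^ e) ^ T.card * ((1 - p) ^ d - (1 - p) ^ e) ^ (U.card - T.card) *
        (1 - (1 - p) ^ d) ^ (n - U.card) := by
  have hrow := iIndepFun_rows hm hi
  have h := hrow.measure_inter_preimage_eq_mul (Finset.range n)
    (sets := fun x => if x ∈ T then zeroCylinder e else
        if x ∈ U then zeroCylinder d \ zeroCylinder e else (zeroCylinder d)ᶜ)
    (fun x _ => measurableSet_cell d e T U x)
  rw [keyEvent_eq hde hTU hU, measureReal_def, h, ENNReal.toReal_prod]
  have hmr : ∀ x, Measurable (fun ω m => bit x m ω) := fun x =>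
    measurable_pi_lambda _ fun m => hm x m
  have hcell : ∀ x, (P ((fun ω m => bit x m ω) ⁻¹' (if x ∈ T then zeroCylinder e else
        if x ∈ U then zeroCylinder d \ zeroCylinder e else (zeroCylinder d)ᶜ))).toReal =
      if x ∈ T then (1 - p) ^ e else
        if x ∈ U then (1 - p) ^ d - (1 - p) ^ e else 1 - (1 - p) ^ d := by
    intro x
    rw [← measureReal_def]
    split_ifs
    · exact real_zeroCylinder hm hi hp x e
    · rw [Set.preimage_sdiff, measureReal_sdiff (Set.preimage_mono (zeroCylinder_anti hde))
        (hmr x (measurableSet_zeroCylinder e)), real_zeroCylinder hm hi hp,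
        real_zeroCylinder hm hi hp]
    · rw [Set.preimage_compl, probReal_compl_eq_one_sub (hmr x (measurableSet_zeroCylinder d)),
        real_zeroCylinder hm hi hp]
  simp only [hcell]
  rw [Finset.prod_ite, Finset.prod_ite]
  simp only [Finset.prod_const]
  have c1 : (Finset.range n).filter (· ∈ T) = T := by
    ext x; simp only [Finset.mem_filter]; exact ⟨fun h => h.2, fun h => ⟨hU (hTU h), h⟩⟩
  have c2 : ((Finset.range n).filter (· ∉ T)).filter (· ∈ U) = U \ T := by
    ext x; simp only [Finset.mem_filter, Finset.mem_sdiff]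
    exact ⟨fun h => ⟨h.2, h.1.2⟩, fun h => ⟨⟨hU h.1, h.2⟩, h.1⟩⟩
  have c3 : ((Finset.range n).filter (· ∉ T)).filter (· ∉ U) = Finset.range n \ U := by
    ext x; simp only [Finset.mem_filter, Finset.mem_sdiff]
    exact ⟨fun h => ⟨h.1.1, h.2⟩, fun h => ⟨⟨h.1, fun hT => h.2 (hTU hT)⟩, h.2⟩⟩
  rw [c1, c2, c3, Finset.card_sdiff_of_subset hTU, Finset.card_sdiff_of_subset hU,
    Finset.card_range, mul_assoc]

/-- `u` keys have at least `d` and `t` keys have at least `e` leading zeros. -/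
def countEvent (bit : ℕ → ℕ → Ω → Bool) (n d e t u : ℕ) : Set Ω :=
  {ω | (zeroKeys (fun x m => bit x m ω) (Finset.range n) e).card = t ∧
    (zeroKeys (fun x m => bit x m ω) (Finset.range n) d).card = u}

omit [MeasurableSpace Ω] in
lemma countEvent_eq {n d e t u : ℕ} (hde : d ≤ e) :
    countEvent bit n d e t u = ⋃ U ∈ Finset.powersetCard u (Finset.range n),
      ⋃ T ∈ Finset.powersetCard t U, keyEvent bit n d e T U := by
  ext ω
  simp only [countEvent, keyEvent, Set.mem_ofPred_eq, Set.mem_iUnion, Finset.mem_powersetCard,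
    exists_prop]
  constructor
  · rintro ⟨h1, h2⟩
    exact ⟨_, ⟨Finset.filter_subset _ _, h2⟩, _, ⟨zeroKeys_anti _ hde, h1⟩, rfl, rfl⟩
  · rintro ⟨U, ⟨-, hU⟩, T, ⟨-, hT⟩, h1, h2⟩
    exact ⟨h1 ▸ hT, h2 ▸ hU⟩

lemma measurableSet_countEvent (hm : ∀ x m, Measurable (bit x m)) {n d e t u : ℕ} (hde : d ≤ e) :
    MeasurableSet (countEvent bit n d e t u) := by
  rw [countEvent_eq hde]
  refine Finset.measurableSet_biUnion _ fun U hU => Finset.measurableSet_biUnion _ fun T hT => ?_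
  rw [Finset.mem_powersetCard] at hU hT
  exact measurableSet_keyEvent hm hde hT.1 hU.1

lemma real_countEvent [IsProbabilityMeasure P] (hm : ∀ x m, Measurable (bit x m))
    (hi : iIndepFun (fun xm : ℕ × ℕ => bit xm.1 xm.2) P)
    (hp : ∀ x m, P.real {ω | bit x m ω = true} = p) {n d e t u : ℕ} (hde : d ≤ e) :
    P.real (countEvent bit n d e t u) = (n.choose u) * (u.choose t) *
      (((1 - p) ^ e) ^ t * ((1 - p) ^ d - (1 - p) ^ e) ^ (u - t) *
        (1 - (1 - p) ^ d) ^ (n - u)) := by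
  rw [countEvent_eq hde, measureReal_biUnion_finset (h := fun _ _ => measure_ne_top _ _)]
  · have : ∀ U ∈ Finset.powersetCard u (Finset.range n),
        P.real (⋃ T ∈ Finset.powersetCard t U, keyEvent bit n d e T U) =
        (u.choose t) * (((1 - p) ^ e) ^ t * ((1 - p) ^ d - (1 - p) ^ e) ^ (u - t) *
        (1 - (1 - p) ^ d) ^ (n - u)) := by
      intro U hU
      rw [Finset.mem_powersetCard] at hU
      rw [measureReal_biUnion_finset]
      · have : ∀ T ∈ Finset.powersetCard t U, P.real (keyEvent bit n d e T U) =
            ((1 - p) ^ e) ^ t * ((1 - p) ^ d - (1 - p) ^ e) ^ (u - t) *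
              (1 - (1 - p) ^ d) ^ (n - u) := by
          intro T hT
          rw [Finset.mem_powersetCard] at hT
          rw [real_keyEvent hm hi hp hde hT.1 hU.1, hT.2, hU.2]
        rw [Finset.sum_congr rfl this]
        simp [hU.2]
      · intro T _ T' _ hne
        rw [Function.onFun, Set.disjoint_left]
        rintro ω ⟨h1, -⟩ ⟨h2, -⟩
        exact hne (h1.symm.trans h2)
      · intro T hT
        rw [Finset.mem_powersetCard] at hT
        exact measurableSet_keyEvent hm hde hT.1 hU.1
    rw [Finset.sum_congr rfl this]
    simp [mul_assoc]
  · intro U _ U' _ hne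
    rw [Function.onFun, Set.disjoint_left]
    simp only [Set.mem_iUnion]
    rintro ω ⟨_, _, -, h1⟩ ⟨_, _, -, h2⟩
    exact hne (h1.symm.trans h2)
  · intro U hU
    rw [Finset.mem_powersetCard] at hU
    refine Finset.measurableSet_biUnion _ fun T hT => ?_
    rw [Finset.mem_powersetCard] at hT
    exact measurableSet_keyEvent hm hde hT.1 hU.1

/-- Almost surely, every hash value contains the bit `1`. -/
lemma ae_exists_bit_eq_true [IsProbabilityMeasure P] (hp0 : 0 < p) (hp1 : p < 1)
    (hm : ∀ x m, Measurable (bit x m))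
    (hi : iIndepFun (fun xm : ℕ × ℕ => bit xm.1 xm.2) P)
    (hp : ∀ x m, P.real {ω | bit x m ω = true} = p) :
    ∀ᵐ ω ∂P, ∀ x, ∃ m, bit x m ω = true := by
  rw [ae_all_iff]
  intro x
  have hle : ∀ d : ℕ, P.real {ω | ¬ ∃ m, bit x m ω = true} ≤ (1 - p) ^ d := by
    intro d
    rw [← real_zeroCylinder hm hi hp x d]
    refine measureReal_mono ?_
    intro ω hω m _
    simpa using fun h => hω ⟨m, h⟩
  have h0 : P.real {ω | ¬ ∃ m, bit x m ω = true} ≤ 0 :=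
    ge_of_tendsto' (tendsto_pow_atTop_nhds_zero_of_lt_one (by linarith) (by linarith)) hle
  have := le_antisymm h0 measureReal_nonneg
  rw [measureReal_eq_zero_iff] at this
  exact this

end Law

/-! ### Moments as series over the values of the depth. -/

section Moments

variable {Ω : Type*} [MeasurableSpace Ω] {P : Measure Ω} [IsProbabilityMeasure P] {D R : Ω → ℕ}

lemma integrable_pow_sub_of_summable (hD : Measurable D) (x : ℝ) (j : ℕ)
    (hs : Summable fun d : ℕ => |(d : ℝ) - x| ^ j * P.real {ω | D ω = d}) :
    Integrable (fun ω => ((D ω : ℝ) - x) ^ j) P := by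
  have hmd : ∀ d, MeasurableSet {ω | D ω = d} := fun d => hD (measurableSet_singleton d)
  have hU : (⋃ d, {ω | D ω = d}) = Set.univ := by ext; simp
  rw [← integrableOn_univ, ← hU]
  have hcongr : ∀ d : ℕ, Set.EqOn (fun ω => ((D ω : ℝ) - x) ^ j) (fun _ => ((d : ℝ) - x) ^ j)
      {ω | D ω = d} := fun d ω hω => by simp only [Set.mem_ofPred_eq] at hω; simp [hω]
  refine integrableOn_iUnion_of_summable_integral_norm (fun d => ?_) ?_
  · rw [integrableOn_congr_fun (hcongr d) (hmd d)]
    exact integrableOn_const (measure_ne_top _ _)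
  · convert hs using 2 with d
    rw [setIntegral_congr_fun (g := fun _ => |(d : ℝ) - x| ^ j) (hmd d)]
    · simp [mul_comm]
    · intro ω hω
      simp only [hcongr d hω, norm_pow, Real.norm_eq_abs]

omit [IsProbabilityMeasure P] in
lemma hasSum_setIntegral_pow_sub (hD : Measurable D) (hR : Measurable R) (x : ℝ) (j k : ℕ)
    (hint : Integrable (fun ω => ((D ω : ℝ) - x) ^ j) P) :
    HasSum (fun d : ℕ => ((d : ℝ) - x) ^ j * P.real {ω | D ω = d ∧ R ω = k})
      (∫ ω in {ω | R ω = k}, ((D ω : ℝ) - x) ^ j ∂P) := by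
  have hmd : ∀ d, MeasurableSet {ω | D ω = d ∧ R ω = k} := fun d =>
    (hD (measurableSet_singleton d)).inter (hR (measurableSet_singleton k))
  have hU : {ω | R ω = k} = ⋃ d, {ω | D ω = d ∧ R ω = k} := by ext; simp
  rw [hU]
  have := hasSum_integral_iUnion hmd (f := fun ω => ((D ω : ℝ) - x) ^ j) (μ := P)
    (fun d e hne => by
      rw [Function.onFun, Set.disjoint_left]
      rintro ω ⟨h1, -⟩ ⟨h2, -⟩
      exact hne (h1.symm.trans h2)) hint.integrableOn
  refine this.congr_fun fun d => ?_
  rw [setIntegral_congr_fun (g := fun _ => ((d : ℝ) - x) ^ j) (hmd d)]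
  · simp [mul_comm]
  · rintro ω ⟨hω, -⟩
    simp [hω]

end Moments

end AdaptiveSampling

/-! ### Joint law of the final depth and size. -/

namespace AdaptiveSampling

/-- The binomial probability of `m` successes in `n` trials with success probability `u`. -/
def binProb (n m : ℕ) (u : ℝ) : ℝ := n.choose m * u ^ m * (1 - u) ^ (n - m)

section JointLaw

variable {Ω : Type*} [MeasurableSpace Ω] {P : Measure Ω} [IsProbabilityMeasure P]
  {bit : ℕ → ℕ → Ω → Bool} {p : ℝ} {b n : ℕ} {S : List ℕ} {D R : Ω → ℕ}

lemma ae_depth_size (hp0 : 0 < p) (hp1 : p < 1)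
    (hm : ∀ x m, Measurable (bit x m))
    (hi : iIndepFun (fun xm : ℕ × ℕ => bit xm.1 xm.2) P)
    (hp : ∀ x m, P.real {ω | bit x m ω = true} = p)
    (hS : S.toFinset = Finset.range n)
    (hD : ∀ ω, D ω = finalDepth b (fun x m => bit x m ω) S)
    (hR : ∀ ω, R ω = finalSize b (fun x m => bit x m ω) S) :
    ∀ᵐ ω ∂P, (∀ x, ∃ m, bit x m ω = true) ∧
      D ω = fitDepth b (fun x m => bit x m ω) (Finset.range n) ∧
      R ω = (zeroKeys (fun x m => bit x m ω) (Finset.range n) (D ω)).card := by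
  filter_upwards [ae_exists_bit_eq_true hp0 hp1 hm hi hp] with ω hω
  refine ⟨hω, ?_, ?_⟩
  · rw [hD, finalDepth_eq hω, hS]
  · rw [hR, hD, finalSize_eq hω, finalDepth_eq hω, hS]

lemma ae_size_le (hp0 : 0 < p) (hp1 : p < 1)
    (hm : ∀ x m, Measurable (bit x m))
    (hi : iIndepFun (fun xm : ℕ × ℕ => bit xm.1 xm.2) P)
    (hp : ∀ x m, P.real {ω | bit x m ω = true} = p)
    (hS : S.toFinset = Finset.range n)
    (hD : ∀ ω, D ω = finalDepth b (fun x m => bit x m ω) S)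
    (hR : ∀ ω, R ω = finalSize b (fun x m => bit x m ω) S) :
    ∀ᵐ ω ∂P, R ω ≤ b := by
  filter_upwards [ae_depth_size hp0 hp1 hm hi hp hS hD hR] with ω ⟨hω, h1, h2⟩
  rw [h2, h1]
  exact card_zeroKeys_fitDepth hω _

lemma ae_depth_pos (hp0 : 0 < p) (hp1 : p < 1)
    (hm : ∀ x m, Measurable (bit x m))
    (hi : iIndepFun (fun xm : ℕ × ℕ => bit xm.1 xm.2) P)
    (hp : ∀ x m, P.real {ω | bit x m ω = true} = p)
    (hS : S.toFinset = Finset.range n)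
    (hD : ∀ ω, D ω = finalDepth b (fun x m => bit x m ω) S)
    (hR : ∀ ω, R ω = finalSize b (fun x m => bit x m ω) S) (hn : b < n) :
    ∀ᵐ ω ∂P, 0 < D ω := by
  filter_upwards [ae_depth_size hp0 hp1 hm hi hp hS hD hR] with ω ⟨hω, h1, h2⟩
  by_contra h0
  have := (fitDepth_le_iff (b := b) hω (Finset.range n) 0).1 (by omega)
  rw [zeroKeys_zero, Finset.card_range] at this
  omega

/-- At least as many keys survive at depth `d` as at depth `d + 1`. Given `k` survivors at `d + 1`,
failure to overflow at `d` thus means `k + i` survivors with `0 ≤ i ≤ b - k`; these finitely many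
events are removed. -/
lemma depth_size_ae_eq (hp0 : 0 < p) (hp1 : p < 1)
    (hm : ∀ x m, Measurable (bit x m))
    (hi : iIndepFun (fun xm : ℕ × ℕ => bit xm.1 xm.2) P)
    (hp : ∀ x m, P.real {ω | bit x m ω = true} = p)
    (hS : S.toFinset = Finset.range n)
    (hD : ∀ ω, D ω = finalDepth b (fun x m => bit x m ω) S)
    (hR : ∀ ω, R ω = finalSize b (fun x m => bit x m ω) S) (d : ℕ) {k : ℕ} (hk : k ≤ b) :
    ({ω | D ω = d + 1 ∧ R ω = k} : Set Ω) =ᵐ[P]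
      (countEvent bit n (d + 1) (d + 1) k k \
        ⋃ i ∈ Finset.range (b - k + 1), countEvent bit n d (d + 1) k (k + i) : Set Ω) := by
  filter_upwards [ae_depth_size hp0 hp1 hm hi hp hS hD hR] with ω ⟨hω, h1, h2⟩
  refine propext ?_
  change (D ω = d + 1 ∧ R ω = k) ↔ (_ ∧ ¬ _)
  simp only [Set.mem_iUnion, countEvent, Finset.mem_range, exists_prop]
  rw [h2]
  constructor
  · rintro ⟨hd, hr⟩
    rw [hd] at hr
    rw [h1] at hd
    have hd' := ((fitDepth_eq_succ_iff hω _ _).1 hd).2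
    refine ⟨⟨hr, hr⟩, ?_⟩
    rintro ⟨i, hi, -, h4⟩
    omega
  · rintro ⟨⟨hr, -⟩, hno⟩
    have hd : D ω = d + 1 := by
      rw [h1, fitDepth_eq_succ_iff hω]
      refine ⟨hr.le.trans hk, ?_⟩
      by_contra hle
      have hge := Finset.card_le_card (zeroKeys_anti (h := fun x m => bit x m ω)
        (Finset.range n) (Nat.le_succ d))
      rw [Nat.succ_eq_add_one, hr] at hge
      refine hno ⟨(zeroKeys (fun x m => bit x m ω) (Finset.range n) d).card - k,
        by omega, hr, ?_⟩
      omega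
    rw [hd]
    exact ⟨rfl, hr⟩

/-- The comparison `D ≤ d` agrees almost surely with a measurable condition on the survivor count at
the fixed depth `d`, and `R` is almost surely that count at the random depth. The null set of
endless overflow is why only almost-everywhere measurability is claimed. -/
lemma aemeasurable_depth_size (hp0 : 0 < p) (hp1 : p < 1)
    (hm : ∀ x m, Measurable (bit x m))
    (hi : iIndepFun (fun xm : ℕ × ℕ => bit xm.1 xm.2) P)
    (hp : ∀ x m, P.real {ω | bit x m ω = true} = p)
    (hS : S.toFinset = Finset.range n)
    (hD : ∀ ω, D ω = finalDepth b (fun x m => bit x m ω) S)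
    (hR : ∀ ω, R ω = finalSize b (fun x m => bit x m ω) S) :
    AEMeasurable D P ∧ AEMeasurable R P := by
  have hcard : ∀ d : ℕ, Measurable
      fun ω => (zeroKeys (fun x m => bit x m ω) (Finset.range n) d).card := by
    intro d
    refine measurable_to_countable' fun k => ?_
    have h := measurableSet_countEvent hm (n := n) (t := k) (u := k) (le_refl d)
    convert h using 1
    ext ω
    simp [countEvent]
  have hDle : ∀ d, NullMeasurableSet {ω | D ω ≤ d} P := by
    intro d
    have hms : MeasurableSet
        {ω | (zeroKeys (fun x m => bit x m ω) (Finset.range n) d).card ≤ b} :=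
      hcard d measurableSet_Iic
    refine hms.nullMeasurableSet.congr ?_
    filter_upwards [ae_depth_size hp0 hp1 hm hi hp hS hD hR] with ω ⟨hω, h1, _⟩
    refine propext ?_
    change _ ↔ D ω ≤ d
    rw [h1, fitDepth_le_iff hω]
    rfl
  have hDm : NullMeasurable D P := by
    intro s _
    have hs : D ⁻¹' s = ⋃ d ∈ s, ({ω | D ω ≤ d} \ ⋃ e ∈ Finset.range d, {ω | D ω ≤ e}) := by
      ext ω
      simp only [Set.mem_preimage, Set.mem_iUnion, Set.mem_sdiff, Set.mem_ofPred_eq,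
        Finset.mem_range, exists_prop]
      constructor
      · exact fun h => ⟨_, h, le_rfl, fun ⟨e, h1, h2⟩ => by omega⟩
      · rintro ⟨d, hd, h1, h2⟩
        have : D ω = d := by
          by_contra hne
          exact h2 ⟨D ω, by omega, le_rfl⟩
        rwa [this]
    rw [hs]
    exact NullMeasurableSet.biUnion (Set.to_countable s) fun d _ => (hDle d).diff
      (NullMeasurableSet.biUnion (Set.to_countable _) fun e _ => hDle e)
  have hDa : AEMeasurable D P := hDm.aemeasurable
  refine ⟨hDa, ?_⟩
  have h2 : Measurable fun ω =>
      (zeroKeys (fun x m => bit x m ω) (Finset.range n) (hDa.mk D ω)).card := by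
    have : Measurable fun dω : ℕ × Ω =>
        (zeroKeys (fun x m => bit x m dω.2) (Finset.range n) dω.1).card :=
      measurable_from_prod_countable_right fun d => hcard d
    exact this.comp (hDa.measurable_mk.prodMk measurable_id)
  refine ⟨_, h2, ?_⟩
  filter_upwards [ae_depth_size hp0 hp1 hm hi hp hS hD hR, hDa.ae_eq_mk] with ω ⟨_, _, h⟩ h'
  rw [h, h']

/-- The joint law of the final depth and the final cache size. -/
theorem real_depth_size (hp0 : 0 < p) (hp1 : p < 1)
    (hm : ∀ x m, Measurable (bit x m))
    (hi : iIndepFun (fun xm : ℕ × ℕ => bit xm.1 xm.2) P)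
    (hp : ∀ x m, P.real {ω | bit x m ω = true} = p)
    (hS : S.toFinset = Finset.range n)
    (hD : ∀ ω, D ω = finalDepth b (fun x m => bit x m ω) S)
    (hR : ∀ ω, R ω = finalSize b (fun x m => bit x m ω) S) (d : ℕ) {k : ℕ} (hk : k ≤ b) :
    P.real {ω | D ω = d + 1 ∧ R ω = k} = binProb n k ((1 - p) ^ (d + 1)) -
      ∑ i ∈ Finset.range (b - k + 1), ((k + i).choose k * (1 - p) ^ k * p ^ i) *
        binProb n (k + i) ((1 - p) ^ d) := by
  rw [measureReal_congr (depth_size_ae_eq hp0 hp1 hm hi hp hS hD hR d hk), measureReal_sdiff,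
    real_countEvent hm hi hp le_rfl, measureReal_biUnion_finset (h := fun _ _ => measure_ne_top _ _)]
  · congr 1
    · simp [binProb, mul_assoc]
    · refine Finset.sum_congr rfl fun i _ => ?_
      rw [real_countEvent hm hi hp (Nat.le_succ d), binProb]
      -- Having exactly `d` leading zeros means `d` zeros and then a one; this is the source of the
      -- factor `p^i`.
      have : (1 - p) ^ d - (1 - p) ^ d.succ = (1 - p) ^ d * p := by
        rw [Nat.succ_eq_add_one, pow_succ]; ring
      rw [this, Nat.add_sub_cancel_left, mul_pow, Nat.succ_eq_add_one, pow_succ, mul_pow,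
        pow_add _ k i]
      ring
  · intro i _ i' _ hne
    rw [Function.onFun, Set.disjoint_left]
    rintro ω ⟨-, h1⟩ ⟨-, h2⟩
    omega
  · exact fun i _ => measurableSet_countEvent hm (Nat.le_succ d)
  · refine Set.iUnion₂_subset fun i _ => ?_
    rintro ω ⟨h1, -⟩
    exact ⟨h1, h1⟩
  · exact Finset.measurableSet_biUnion _ fun i _ => measurableSet_countEvent hm (Nat.le_succ d)

/-- Overflow at depth `d` needs at least one key with `d` leading zeros; a union bound suffices. The
geometric tail gives all moments. -/
lemma real_depth_le (hp0 : 0 < p) (hp1 : p < 1)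
    (hm : ∀ x m, Measurable (bit x m))
    (hi : iIndepFun (fun xm : ℕ × ℕ => bit xm.1 xm.2) P)
    (hp : ∀ x m, P.real {ω | bit x m ω = true} = p)
    (hS : S.toFinset = Finset.range n)
    (hD : ∀ ω, D ω = finalDepth b (fun x m => bit x m ω) S)
    (hR : ∀ ω, R ω = finalSize b (fun x m => bit x m ω) S) (d : ℕ) :
    P.real {ω | D ω = d + 1} ≤ n * (1 - p) ^ d := by
  have hle : P {ω | D ω = d + 1} ≤
      P (⋃ x ∈ Finset.range n, (fun ω m => bit x m ω) ⁻¹' zeroCylinder d) := by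
    refine measure_mono_ae ?_
    filter_upwards [ae_depth_size hp0 hp1 hm hi hp hS hD hR] with ω ⟨hω, h1, _⟩ hd
    have hd' : D ω = d + 1 := hd
    rw [h1, fitDepth_eq_succ_iff hω] at hd'
    obtain ⟨x, hx⟩ := Finset.card_pos.1 ((Nat.zero_le b).trans_lt hd'.2)
    rw [zeroKeys, Finset.mem_filter] at hx
    exact Set.mem_iUnion₂.2 ⟨x, hx.1, hx.2⟩
  refine (ENNReal.toReal_mono (measure_ne_top _ _) hle).trans ?_
  refine (measureReal_biUnion_finset_le _ _).trans ?_
  simp [real_zeroCylinder hm hi hp]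

lemma integrable_pow_depth_sub (hp0 : 0 < p) (hp1 : p < 1)
    (hm : ∀ x m, Measurable (bit x m))
    (hi : iIndepFun (fun xm : ℕ × ℕ => bit xm.1 xm.2) P)
    (hp : ∀ x m, P.real {ω | bit x m ω = true} = p)
    (hS : S.toFinset = Finset.range n)
    (hD : ∀ ω, D ω = finalDepth b (fun x m => bit x m ω) S)
    (hR : ∀ ω, R ω = finalSize b (fun x m => bit x m ω) S) (x : ℝ) (j : ℕ) :
    Integrable (fun ω => ((D ω : ℝ) - x) ^ j) P := by
  obtain ⟨hDa, -⟩ := aemeasurable_depth_size hp0 hp1 hm hi hp hS hD hR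
  have hcongr : ∀ d, P.real {ω | hDa.mk D ω = d} = P.real {ω | D ω = d} := by
    intro d
    refine measureReal_congr ?_
    filter_upwards [hDa.ae_eq_mk] with ω h
    refine propext ?_
    change hDa.mk D ω = d ↔ D ω = d
    rw [h]
  have hint : Integrable (fun ω => (((hDa.mk D ω : ℕ) : ℝ) - x) ^ j) P := by
    refine integrable_pow_sub_of_summable hDa.measurable_mk x j ?_
    simp only [hcongr]
    rw [← summable_nat_add_iff 1]
    have hq : ‖(1 - p : ℝ)‖ < 1 := by
      rw [Real.norm_eq_abs, abs_lt]; constructor <;> linarith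
    have hgeom : Summable fun d : ℕ =>
        n * (2 ^ (j - 1) * (((d : ℝ) ^ j * (1 - p) ^ d) + |1 - x| ^ j * (1 - p) ^ d)) :=
      (((summable_pow_mul_geometric_of_norm_lt_one j hq).add
        ((summable_geometric_of_norm_lt_one hq).mul_left _)).mul_left _).mul_left _
    refine hgeom.of_nonneg_of_le (fun d => by positivity) fun d => ?_
    have h1 := real_depth_le hp0 hp1 hm hi hp hS hD hR d
    have h2 : |((d + 1 : ℕ) : ℝ) - x| ^ j ≤ 2 ^ (j - 1) * ((d : ℝ) ^ j + |1 - x| ^ j) := by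
      refine le_trans ?_ (add_pow_le (by positivity) (abs_nonneg _) j)
      refine pow_le_pow_left₀ (abs_nonneg _) ?_ j
      have : ((d + 1 : ℕ) : ℝ) - x = d + (1 - x) := by push_cast; ring
      rw [this]
      refine (abs_add_le _ _).trans ?_
      rw [Nat.abs_cast]
    calc _ ≤ (2 ^ (j - 1) * ((d : ℝ) ^ j + |1 - x| ^ j)) * (n * (1 - p) ^ d) := by gcongr
      _ = _ := by ring
  refine hint.congr ?_
  filter_upwards [hDa.ae_eq_mk] with ω h
  exact congrArg (fun t : ℕ => ((t : ℝ) - x) ^ j) h.symm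

lemma hasSum_setIntegral_pow_depth_sub (hp0 : 0 < p) (hp1 : p < 1)
    (hm : ∀ x m, Measurable (bit x m))
    (hi : iIndepFun (fun xm : ℕ × ℕ => bit xm.1 xm.2) P)
    (hp : ∀ x m, P.real {ω | bit x m ω = true} = p)
    (hS : S.toFinset = Finset.range n)
    (hD : ∀ ω, D ω = finalDepth b (fun x m => bit x m ω) S)
    (hR : ∀ ω, R ω = finalSize b (fun x m => bit x m ω) S) (x : ℝ) (j k : ℕ) :
    HasSum (fun d : ℕ => ((d : ℝ) - x) ^ j * P.real {ω | D ω = d ∧ R ω = k})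
      (∫ ω in {ω | R ω = k}, ((D ω : ℝ) - x) ^ j ∂P) := by
  obtain ⟨hDa, hRa⟩ := aemeasurable_depth_size hp0 hp1 hm hi hp hS hD hR
  have hcongr : ∀ d, P.real {ω | hDa.mk D ω = d ∧ hRa.mk R ω = k} =
      P.real {ω | D ω = d ∧ R ω = k} := by
    intro d
    refine measureReal_congr ?_
    filter_upwards [hDa.ae_eq_mk, hRa.ae_eq_mk] with ω h h'
    refine propext ?_
    change (hDa.mk D ω = d ∧ hRa.mk R ω = k) ↔ (D ω = d ∧ R ω = k)
    rw [h, h']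
  have hset : ({ω | R ω = k} : Set Ω) =ᵐ[P] ({ω | hRa.mk R ω = k} : Set Ω) := by
    filter_upwards [hRa.ae_eq_mk] with ω h'
    refine propext ?_
    change R ω = k ↔ hRa.mk R ω = k
    rw [h']
  have hint := integrable_pow_depth_sub hp0 hp1 hm hi hp hS hD hR x j
  have hae : (fun ω => ((D ω : ℝ) - x) ^ j) =ᵐ[P] fun ω => (((hDa.mk D ω : ℕ) : ℝ) - x) ^ j := by
    filter_upwards [hDa.ae_eq_mk] with ω h
    exact congrArg (fun t : ℕ => ((t : ℝ) - x) ^ j) h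
  have h := hasSum_setIntegral_pow_sub hDa.measurable_mk hRa.measurable_mk x j k (hint.congr hae)
  simp only [hcongr] at h
  rwa [setIntegral_congr_set hset, integral_congr_ae (ae_restrict_of_ae hae)]

lemma integral_pow_depth_sub_eq_sum (hp0 : 0 < p) (hp1 : p < 1)
    (hm : ∀ x m, Measurable (bit x m))
    (hi : iIndepFun (fun xm : ℕ × ℕ => bit xm.1 xm.2) P)
    (hp : ∀ x m, P.real {ω | bit x m ω = true} = p)
    (hS : S.toFinset = Finset.range n)
    (hD : ∀ ω, D ω = finalDepth b (fun x m => bit x m ω) S)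
    (hR : ∀ ω, R ω = finalSize b (fun x m => bit x m ω) S) (x : ℝ) (j : ℕ) :
    ∫ ω, ((D ω : ℝ) - x) ^ j ∂P =
      ∑ k ∈ Finset.range (b + 1), ∫ ω in {ω | R ω = k}, ((D ω : ℝ) - x) ^ j ∂P := by
  obtain ⟨-, hRa⟩ := aemeasurable_depth_size hp0 hp1 hm hi hp hS hD hR
  have hint := integrable_pow_depth_sub hp0 hp1 hm hi hp hS hD hR x j
  have hset : ∀ k, ({ω | R ω = k} : Set Ω) =ᵐ[P] ({ω | hRa.mk R ω = k} : Set Ω) := by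
    intro k
    filter_upwards [hRa.ae_eq_mk] with ω h'
    refine propext ?_
    change R ω = k ↔ hRa.mk R ω = k
    rw [h']
  simp only [fun k => setIntegral_congr_set (f := fun ω => ((D ω : ℝ) - x) ^ j) (hset k)]
  rw [← integral_biUnion_finset]
  · rw [← setIntegral_univ]
    refine setIntegral_congr_set ?_
    filter_upwards [ae_size_le hp0 hp1 hm hi hp hS hD hR, hRa.ae_eq_mk] with ω h h'
    refine propext ?_
    change True ↔ ω ∈ (⋃ k ∈ Finset.range (b + 1), {ω | hRa.mk R ω = k})
    simp only [Set.mem_iUnion, Finset.mem_range, true_iff, exists_prop]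
    exact ⟨R ω, by omega, h'.symm⟩
  · exact fun k _ => hRa.measurable_mk (measurableSet_singleton k)
  · intro i _ i' _ hne
    rw [Function.onFun, Set.disjoint_left]
    intro ω h1 h2
    exact hne (h1.symm.trans h2)
  · exact fun k _ => hint.integrableOn

end JointLaw

end AdaptiveSampling

/-! ### Quantitative Poisson approximation. -/

namespace AdaptiveSampling

/-- The Poisson probability of the value `m` for the parameter `t`. -/
noncomputable def poisProb (m : ℕ) (t : ℝ) : ℝ := Real.exp (-t) * t ^ m / m.factorial

lemma pow_mul_exp_neg_le (a : ℕ) {c t : ℝ} (hc : 0 < c) (ht : 0 ≤ t) :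
    t ^ a * Real.exp (-(c * t)) ≤ a.factorial / c ^ a := by
  have h := Real.pow_div_factorial_le_exp (x := c * t) (by positivity) a
  rw [div_le_iff₀ (by positivity), mul_pow] at h
  rw [Real.exp_neg, ← div_eq_mul_inv, div_le_div_iff₀ (Real.exp_pos _) (by positivity)]
  linarith

lemma exists_pow_succ_mul_exp_neg_le (a : ℕ) {c e : ℝ} (hce : c < e) :
    ∃ C : ℝ, 0 ≤ C ∧ ∀ t : ℝ, 0 ≤ t →
      t ^ (a + 1) * Real.exp (-(e * t)) ≤ C * (t * Real.exp (-(c * t))) := by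
  refine ⟨a.factorial / (e - c) ^ a, div_nonneg (by positivity) (pow_nonneg (by linarith) _),
    fun t ht => ?_⟩
  have h := pow_mul_exp_neg_le a (sub_pos.2 hce) ht
  have he : Real.exp (-(e * t)) = Real.exp (-((e - c) * t)) * Real.exp (-(c * t)) := by
    rw [← Real.exp_add]; ring_nf
  calc t ^ (a + 1) * Real.exp (-(e * t))
      = (t ^ a * Real.exp (-((e - c) * t))) * (t * Real.exp (-(c * t))) := by rw [he]; ring
    _ ≤ _ := by gcongr

lemma binProb_eq {n m : ℕ} (hn : n ≠ 0) (u : ℝ) :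
    binProb n m u =
      (n * u) ^ m / m.factorial * ((n.descFactorial m / n ^ m : ℝ) * (1 - u) ^ (n - m)) := by
  have hn' : (n : ℝ) ≠ 0 := by exact_mod_cast hn
  rw [binProb, Nat.choose_eq_descFactorial_div_factorial,
    Nat.cast_div (Nat.factorial_dvd_descFactorial n m) (by positivity), mul_pow]
  field_simp

/-- The Poisson approximation of binomial probabilities. -/
lemma abs_binProb_sub_poisProb_le {n m : ℕ} (hn : 0 < n) (hmn : m ≤ n) {u : ℝ} (hu0 : 0 ≤ u)
    (hu1 : u ≤ 1) :
    |binProb n m u - poisProb m (n * u)| ≤ (n * u) ^ m * (Real.exp m * Real.exp (-(n * u)) *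
      (m ^ 2 + m * (n * u) + (n * u) ^ 2)) / n := by
  have hn' : (0 : ℝ) < n := by exact_mod_cast hn
  set t : ℝ := n * u with ht
  have ht0 : 0 ≤ t := by positivity
  set ρ : ℝ := n.descFactorial m / n ^ m with hρ
  set A : ℝ := (1 - u) ^ (n - m) with hA
  set E : ℝ := Real.exp (-t) with hE
  have hE0 : 0 < E := Real.exp_pos _
  have hρ1 : ρ ≤ 1 := by
    rw [hρ, div_le_one (by positivity)]
    exact_mod_cast Nat.descFactorial_le_pow n m
  have hρ0 : 0 ≤ ρ := by positivity
  -- Here `ρ ≥ (1 - m/n)^m`, and Bernoulli's inequality applies.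
  have hρ2 : 1 - ρ ≤ m ^ 2 / n := by
    have h1 : ((n : ℝ) - m) ^ m ≤ n.descFactorial m := by
      have h := Nat.pow_sub_le_descFactorial n m
      have h' : (n - m) ^ m ≤ n.descFactorial m :=
        (Nat.pow_le_pow_left (by omega) m).trans h
      rw [← Nat.cast_sub hmn]
      exact_mod_cast h'
    have hmn' : (m : ℝ) / n ≤ 1 := by
      rw [div_le_one hn']; exact_mod_cast hmn
    have h2 : 1 + (m : ℝ) * (-(m / n)) ≤ (1 + -((m : ℝ) / n)) ^ m :=
      one_add_mul_le_pow (by linarith) m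
    have h3 : (1 + -((m : ℝ) / n)) ^ m ≤ ρ := by
      have : (1 + -((m : ℝ) / n)) * n = n - m := by
        rw [add_mul, neg_mul, div_mul_cancel₀ _ hn'.ne']; ring
      rw [hρ, le_div_iff₀ (by positivity), ← mul_pow, this]
      exact h1
    have : (m : ℝ) ^ 2 / n = m * (m / n) := by ring
    rw [this]
    linarith
  have hA0 : 0 ≤ A := pow_nonneg (by linarith) _
  have hAe : A ≤ Real.exp (m * u) * E := by
    have h1 : A ≤ Real.exp (-u) ^ (n - m) :=
      pow_le_pow_left₀ (by linarith) (Real.one_sub_le_exp_neg u) _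
    refine h1.trans (le_of_eq ?_)
    rw [← Real.exp_nat_mul, hE, ← Real.exp_add, Nat.cast_sub hmn, ht]
    ring_nf
  have hmu : Real.exp (m * u) ≤ Real.exp m := by
    rw [Real.exp_le_exp]
    exact mul_le_of_le_one_right (by positivity) hu1
  have hem : 1 ≤ Real.exp m := Real.one_le_exp (by positivity)
  have hup : A - E ≤ Real.exp m * E * (m * t) / n := by
    have h1 : Real.exp (m * u) - 1 ≤ m * u * Real.exp (m * u) := by
      have := Real.one_sub_le_exp_neg (m * u)
      rw [Real.exp_neg] at this
      have hpos := Real.exp_pos (m * u)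
      have h2 := mul_le_mul_of_nonneg_right this hpos.le
      rw [inv_mul_cancel₀ hpos.ne'] at h2
      linarith
    calc A - E ≤ (Real.exp (m * u) - 1) * E := by linarith
      _ ≤ (m * u * Real.exp (m * u)) * E := by gcongr
      _ ≤ (m * u * Real.exp m) * E := by gcongr
      _ = _ := by rw [ht]; field_simp
  -- Factor out `e^(-nu)`: since `(1 - u)e^u ≥ 1 - u²`, Bernoulli's inequality bounds the remaining
  -- `n`-th power below by `1 - n u²`.
  have hlo : E - A ≤ E * t ^ 2 / n := by
    have h1 : (1 - u) ^ n ≤ A := pow_le_pow_of_le_one (by linarith) (by linarith) (Nat.sub_le n m)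
    have h2 : (1 - u) ^ n = E * ((1 - u) * Real.exp u) ^ n := by
      rw [mul_pow, ← Real.exp_nat_mul, hE, ht, mul_comm, mul_assoc, ← Real.exp_add]
      simp
    have h3 : 1 - u ^ 2 ≤ (1 - u) * Real.exp u := by
      have := Real.add_one_le_exp u
      nlinarith
    have h4 : 1 - n * u ^ 2 ≤ ((1 - u) * Real.exp u) ^ n := by
      have h5 : 1 + (n : ℝ) * (-u ^ 2) ≤ (1 + -u ^ 2) ^ n := one_add_mul_le_pow (by nlinarith) n
      have h6 : (1 + -u ^ 2) ^ n ≤ ((1 - u) * Real.exp u) ^ n :=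
        pow_le_pow_left₀ (by nlinarith) (by linarith) n
      linarith
    have h7 : E * (1 - n * u ^ 2) ≤ A := by
      refine le_trans ?_ h1
      rw [h2]
      gcongr
    have : E * t ^ 2 / n = E * (n * u ^ 2) := by rw [ht]; field_simp
    rw [this]
    linarith
  have hmain : |ρ * A - E| ≤ Real.exp m * E * (m ^ 2 + m * t + t ^ 2) / n := by
    have h1 : (1 - ρ) * A ≤ m ^ 2 / n * (Real.exp m * E) := by
      have : A ≤ Real.exp m * E := hAe.trans (by gcongr)
      gcongr
    have h1' : 0 ≤ (1 - ρ) * A := mul_nonneg (by linarith) hA0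
    have h2 : E * t ^ 2 / n ≤ Real.exp m * E * t ^ 2 / n := by
      gcongr
      exact le_mul_of_one_le_left hE0.le hem
    have h3 : 0 ≤ Real.exp m * E * (m * t) / n := by positivity
    have h4 : 0 ≤ m ^ 2 / n * (Real.exp m * E) := by positivity
    have h5 : Real.exp m * E * (m ^ 2 + m * t + t ^ 2) / n =
      m ^ 2 / n * (Real.exp m * E) + Real.exp m * E * (m * t) / n +
        Real.exp m * E * t ^ 2 / n := by ring
    have h6 : 0 ≤ Real.exp m * E * t ^ 2 / n := by positivity
    rw [h5, abs_le]
    constructor <;> linarith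
  have heq : binProb n m u - poisProb m t = t ^ m / m.factorial * (ρ * A - E) := by
    rw [binProb_eq hn.ne', poisProb]; ring
  rw [heq, abs_mul, abs_of_nonneg (by positivity : 0 ≤ t ^ m / (m.factorial : ℝ)), mul_div_assoc]
  gcongr
  exact div_le_self (by positivity) (by exact_mod_cast Nat.one_le_iff_ne_zero.2 m.factorial_ne_zero)

/-- The polynomial factors are absorbed by giving up half of the exponent, but one factor `t = nu`
is kept: with `t = e^(-Lη)` it provides the decay as `η → ∞`, and `e^(-t/2)` the decay as `η → -∞`.
-/
lemma exists_abs_binProb_sub_poisProb_le (m : ℕ) :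
    ∃ C : ℝ, 0 ≤ C ∧ ∀ n : ℕ, 0 < n → m ≤ n → ∀ u : ℝ, 0 ≤ u → u ≤ 1 →
      |binProb n m u - poisProb m (n * u)| ≤
        C / n * ((n * u) * Real.exp (-(1 / 2 * (n * u)))) := by
  have key : ∃ C : ℝ, 0 ≤ C ∧ ∀ t : ℝ, 0 ≤ t →
      t ^ m * (Real.exp m * Real.exp (-t) * (m ^ 2 + m * t + t ^ 2)) ≤
        C * (t * Real.exp (-(1 / 2 * t))) := by
    have h12 : (1 / 2 : ℝ) < 1 := by norm_num
    obtain ⟨C1, hC1, h1⟩ := exists_pow_succ_mul_exp_neg_le m h12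
    obtain ⟨C2, hC2, h2⟩ := exists_pow_succ_mul_exp_neg_le (m + 1) h12
    obtain ⟨C0, hC0, h0⟩ := exists_pow_succ_mul_exp_neg_le (m - 1) h12
    refine ⟨Real.exp m * (m ^ 2 * C0 + m * C1 + C2), by positivity, fun t ht => ?_⟩
    specialize h0 t ht; specialize h1 t ht; specialize h2 t ht
    rw [one_mul] at h0 h1 h2
    -- For `m = 0` there is no factor `t` to keep, but the coefficient `m ^ 2` vanishes.
    have h0' : (m : ℝ) ^ 2 * (t ^ m * Real.exp (-t)) ≤
        m ^ 2 * (C0 * (t * Real.exp (-(1 / 2 * t)))) := by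
      rcases Nat.eq_zero_or_pos m with rfl | hm
      · simp
      · rw [Nat.sub_add_cancel hm] at h0
        gcongr
    calc _ = Real.exp m * (m ^ 2 * (t ^ m * Real.exp (-t)) +
          m * (t ^ (m + 1) * Real.exp (-t)) + t ^ (m + 1 + 1) * Real.exp (-t)) := by ring
      _ ≤ Real.exp m * (m ^ 2 * (C0 * (t * Real.exp (-(1 / 2 * t)))) +
          m * (C1 * (t * Real.exp (-(1 / 2 * t)))) + C2 * (t * Real.exp (-(1 / 2 * t)))) := by
        gcongr
      _ = _ := by ring
  obtain ⟨C, hC, h⟩ := key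
  refine ⟨C, hC, fun n hn hmn u hu0 hu1 => ?_⟩
  refine (abs_binProb_sub_poisProb_le hn hmn hu0 hu1).trans ?_
  rw [div_mul_eq_mul_div]
  have := h (n * u) (by positivity)
  gcongr

/-! ### The limiting density through Poisson probabilities. -/

section Density

variable {p : ℝ}

lemma L_pos (hp0 : 0 < p) (hp1 : p < 1) : 0 < L p := by
  refine Real.log_pos ?_
  rw [Q, lt_div_iff₀ (by linarith)]
  linarith

lemma exp_neg_L (hp1 : p < 1) : Real.exp (-L p) = 1 - p := by
  rw [L, Q, Real.log_div one_ne_zero (by linarith), Real.log_one, zero_sub, neg_neg,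
    Real.exp_log (by linarith)]

/-- The density `f` in terms of Poisson probabilities. -/
lemma f_eq (hp1 : p < 1) (b k : ℕ) (η : ℝ) :
    f p b k η = poisProb k (Real.exp (-L p * η)) -
      ∑ i ∈ Finset.range (b - k + 1), ((k + i).choose k * (1 - p) ^ k * p ^ i) *
        poisProb (k + i) (Real.exp (-L p * η) / (1 - p)) := by
  have hq : (1 - p) ≠ 0 := by linarith
  set t := Real.exp (-L p * η) with ht
  have h1 : ∀ m : ℕ, Real.exp (-L p * m * η) = t ^ m := by
    intro m; rw [ht, ← Real.exp_nat_mul]; ring_nf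
  rw [f]
  simp only [h1, ← ht]
  rw [mul_sub, mul_one, poisProb]
  congr 1
  · ring
  rw [Finset.mul_sum, Finset.mul_sum]
  refine Finset.sum_congr rfl fun i _ => ?_
  rw [poisProb]
  -- Poisson thinning: a Poisson variable of mean `t/q` splits into independent parts of means `t`
  -- and `t p/q`.
  have hexp : Real.exp (-(t / (1 - p))) = Real.exp (-t) * Real.exp (-t * (p / (1 - p))) := by
    rw [← Real.exp_add]; congr 1; field_simp; ring
  have hch : ((k + i).choose k : ℝ) = (k + i).factorial / (k.factorial * i.factorial) := by
    rw [Nat.cast_choose ℝ (Nat.le_add_right k i), Nat.add_sub_cancel_left]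
  rw [hexp, hch, div_pow, div_pow, pow_add, pow_add]
  have := Nat.factorial_ne_zero k
  have := Nat.factorial_ne_zero i
  have := Nat.factorial_ne_zero (k + i)
  field_simp

lemma f_nonneg (hp0 : 0 < p) (hp1 : p < 1) (b k : ℕ) (η : ℝ) : 0 ≤ f p b k η := by
  have hq : 0 < 1 - p := by linarith
  rw [f]
  refine mul_nonneg (by positivity) ?_
  set t := Real.exp (-L p * η) with ht
  have ht0 : 0 < t := Real.exp_pos _
  have hx : 0 ≤ t * (p / (1 - p)) := by positivity
  have h := Real.sum_le_exp_of_nonneg hx (b - k + 1)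
  have heq : ∑ i ∈ Finset.range (b - k + 1),
        Real.exp (-L p * i * η) * (p / (1 - p)) ^ i / (i.factorial : ℝ) =
      ∑ i ∈ Finset.range (b - k + 1), (t * (p / (1 - p))) ^ i / (i.factorial : ℝ) := by
    refine Finset.sum_congr rfl fun i _ => ?_
    rw [mul_pow, ht, ← Real.exp_nat_mul]
    ring_nf
  rw [heq, neg_mul, Real.exp_neg, sub_nonneg, inv_mul_le_iff₀ (Real.exp_pos _), mul_one]
  exact h

lemma exists_poisProb_le {m : ℕ} (hm : m ≠ 0) : ∃ C : ℝ, 0 ≤ C ∧ ∀ t : ℝ, 0 ≤ t →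
    poisProb m t ≤ C * (t * Real.exp (-(1 / 2 * t))) := by
  obtain ⟨C, hC, h⟩ := exists_pow_succ_mul_exp_neg_le (m - 1) (by norm_num : (1 / 2 : ℝ) < 1)
  refine ⟨C, hC, fun t ht => ?_⟩
  have := h t ht
  rw [Nat.sub_add_cancel (Nat.pos_of_ne_zero hm), one_mul] at this
  rw [poisProb, mul_comm]
  refine (div_le_self (by positivity) ?_).trans this
  exact_mod_cast Nat.one_le_iff_ne_zero.2 m.factorial_ne_zero

lemma poisProb_nonneg (m : ℕ) {t : ℝ} (ht : 0 ≤ t) : 0 ≤ poisProb m t := by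
  rw [poisProb]; positivity

/-- For `k ≥ 1` the leading Poisson term already carries a factor `t`. For `k = 0` the factor comes
from the cancellation `e^(-t) - e^(-t/q) ≤ (p/q) t e^(-t)`, so the term `i = 0` of the subtracted
sum must be kept. -/
lemma exists_f_le (hp0 : 0 < p) (hp1 : p < 1) (b k : ℕ) : ∃ C : ℝ, 0 ≤ C ∧ ∀ η : ℝ,
    f p b k η ≤ C * (Real.exp (-L p * η) * Real.exp (-(1 / 2 * Real.exp (-L p * η)))) := by
  have hq : 0 < 1 - p := by linarith
  rcases eq_or_ne k 0 with rfl | hk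
  · refine ⟨p / (1 - p), by positivity, fun η => ?_⟩
    rw [f_eq hp1]
    set t := Real.exp (-L p * η) with ht
    have ht0 : 0 < t := Real.exp_pos _
    have h1 : poisProb 0 (t / (1 - p)) ≤ ∑ i ∈ Finset.range (b - 0 + 1),
        ((0 + i).choose 0 * (1 - p) ^ 0 * p ^ i) * poisProb (0 + i) (t / (1 - p)) := by
      have := Finset.single_le_sum (f := fun i => ((0 + i).choose 0 * (1 - p) ^ 0 * p ^ i) *
          poisProb (0 + i) (t / (1 - p))) (s := Finset.range (b - 0 + 1)) (a := 0)
        (fun i _ => mul_nonneg (by positivity) (poisProb_nonneg _ (by positivity)))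
        (by simp)
      simpa using this
    have h2 : poisProb 0 t - poisProb 0 (t / (1 - p)) ≤ p / (1 - p) * t * Real.exp (-t) := by
      simp only [poisProb, pow_zero, mul_one, Nat.factorial_zero, Nat.cast_one, div_one]
      have h3 : Real.exp (-(t / (1 - p))) = Real.exp (-t) * Real.exp (-(p / (1 - p) * t)) := by
        rw [← Real.exp_add]; congr 1; field_simp; ring
      have h4 := Real.one_sub_le_exp_neg (p / (1 - p) * t)
      rw [h3]
      nlinarith [Real.exp_pos (-t)]
    have h5 : Real.exp (-t) ≤ Real.exp (-(1 / 2 * t)) := by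
      rw [Real.exp_le_exp]; linarith
    calc _ ≤ p / (1 - p) * t * Real.exp (-t) := by linarith
      _ ≤ p / (1 - p) * t * Real.exp (-(1 / 2 * t)) := by gcongr
      _ = _ := by ring
  · obtain ⟨C, hC, h⟩ := exists_poisProb_le hk
    refine ⟨C, hC, fun η => ?_⟩
    rw [f_eq hp1]
    refine le_trans ?_ (h _ (Real.exp_pos _).le)
    have : 0 ≤ ∑ i ∈ Finset.range (b - k + 1), ((k + i).choose k * (1 - p) ^ k * p ^ i) *
        poisProb (k + i) (Real.exp (-L p * η) / (1 - p)) :=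
      Finset.sum_nonneg fun i _ => mul_nonneg (by positivity) (poisProb_nonneg _ (by positivity))
    linarith

end Density

end AdaptiveSampling

/-! ### Exponentially decaying functions and Schwartz regularity. -/

namespace AdaptiveSampling

open scoped SchwartzMap FourierTransform ContDiff

lemma integrable_exp_neg_mul_abs {c : ℝ} (hc : 0 < c) :
    Integrable fun x : ℝ => Real.exp (-(c * |x|)) := by
  rw [← integrableOn_univ, ← Set.Iic_union_Ioi (a := (0 : ℝ))]
  refine IntegrableOn.union ?_ ?_
  · refine (integrableOn_exp_mul_Iic hc 0).congr_fun (fun x hx => ?_) measurableSet_Iic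
    rw [Set.mem_Iic] at hx
    simp [abs_of_nonpos hx]
  · refine (integrableOn_exp_mul_Ioi (neg_lt_zero.2 hc) 0).congr_fun (fun x hx => ?_)
      measurableSet_Ioi
    rw [Set.mem_Ioi] at hx
    simp [abs_of_pos hx]

/-- Sums of `|η|^j e^{-l |η|}` over translates of the integers are bounded uniformly. -/
lemma exists_tsum_pow_mul_exp_le {l : ℝ} (hl : 0 < l) (j : ℕ) : ∃ K : ℝ, ∀ x : ℝ,
    (Summable fun d : ℤ => |(d : ℝ) - x| ^ j * Real.exp (-(l * |(d : ℝ) - x|))) ∧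
      ∑' d : ℤ, |(d : ℝ) - x| ^ j * Real.exp (-(l * |(d : ℝ) - x|)) ≤ K := by
  have hnat : Summable fun d : ℕ => ((d : ℝ) + 1) ^ j * Real.exp (-(l * d)) := by
    have hr : ‖Real.exp (-l)‖ < 1 := by
      rw [Real.norm_of_nonneg (Real.exp_pos _).le, Real.exp_lt_one_iff]; linarith
    have h := summable_pow_mul_geometric_of_norm_lt_one j hr
    rw [← summable_nat_add_iff 1] at h
    refine (h.mul_left (Real.exp l)).congr fun d => ?_
    rw [← Real.exp_nat_mul]
    push_cast
    rw [mul_left_comm, ← Real.exp_add]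
    ring_nf
  -- The majorant for the shift `x` is this series translated by `⌊x⌋`. The `+ 1` and the factor
  -- `e^l` pay for the fractional part of `x`, so the bound does not depend on `x`.
  have hint : Summable fun d : ℤ =>
      Real.exp l * ((|(d : ℝ)| + 1) ^ j * Real.exp (-(l * |(d : ℝ)|))) := by
    refine Summable.mul_left _ (Summable.of_nat_of_neg ?_ ?_) <;> simpa using hnat
  obtain ⟨F, hF⟩ : ∃ F : ℤ → ℝ, F = fun d : ℤ =>
      Real.exp l * ((|(d : ℝ)| + 1) ^ j * Real.exp (-(l * |(d : ℝ)|))) := ⟨_, rfl⟩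
  rw [← hF] at hint
  refine ⟨∑' d : ℤ, F d, fun x => ?_⟩
  have hshift : Summable fun d : ℤ => F (d - ⌊x⌋) := (Equiv.subRight ⌊x⌋).summable_iff.2 hint
  have hle : ∀ d : ℤ, |(d : ℝ) - x| ^ j * Real.exp (-(l * |(d : ℝ) - x|)) ≤ F (d - ⌊x⌋) := by
    intro d
    rw [hF]
    simp only [Int.cast_sub]
    have hfr : |x - ⌊x⌋| ≤ 1 := by
      rw [abs_of_nonneg (sub_nonneg.2 (Int.floor_le x))]
      linarith [Int.lt_floor_add_one x]
    have h1 : |(d : ℝ) - x| ≤ |(d : ℝ) - ⌊x⌋| + 1 := by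
      have : (d : ℝ) - x = (d - ⌊x⌋) - (x - ⌊x⌋) := by ring
      rw [this]
      exact (abs_sub _ _).trans (by linarith)
    have h2 : |(d : ℝ) - ⌊x⌋| ≤ |(d : ℝ) - x| + 1 := by
      have : (d : ℝ) - ⌊x⌋ = (d - x) + (x - ⌊x⌋) := by ring
      rw [this]
      exact (abs_add_le _ _).trans (by linarith)
    have h3 : Real.exp (-(l * |(d : ℝ) - x|)) ≤
        Real.exp l * Real.exp (-(l * |(d : ℝ) - ⌊x⌋|)) := by
      rw [← Real.exp_add, Real.exp_le_exp]
      nlinarith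
    calc _ ≤ (|(d : ℝ) - ⌊x⌋| + 1) ^ j * (Real.exp l * Real.exp (-(l * |(d : ℝ) - ⌊x⌋|))) := by
          gcongr
      _ = _ := by ring
  have hs := hshift.of_nonneg_of_le (fun d => by positivity) hle
  exact ⟨hs, (hs.tsum_le_tsum hle hshift).trans ((Equiv.subRight ⌊x⌋).tsum_eq F).le⟩

section Tame

variable {l : ℝ}

/-- The function `e^{-a l η} exp (-c e^{-l η})`. -/
noncomputable def gumbel (l : ℝ) (a : ℕ) (c η : ℝ) : ℂ :=
  (Real.exp (-l * η) ^ a * Real.exp (-(c * Real.exp (-l * η))) : ℝ)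

lemma hasDerivAt_gumbel (a : ℕ) (c η : ℝ) :
    HasDerivAt (gumbel l a c) (-l * a * gumbel l a c η + c * l * gumbel l (a + 1) c η) η := by
  have h1 : HasDerivAt (fun η => Real.exp (-l * η)) (Real.exp (-l * η) * -l) η := by
    simpa using ((hasDerivAt_id η).const_mul (-l)).exp
  have h2 := ((h1.pow a).mul (h1.const_mul c).neg.exp).ofReal_comp
  refine HasDerivAt.congr_deriv (f := gumbel l a c) h2 ?_
  simp only [gumbel]
  rcases Nat.eq_zero_or_pos a with rfl | ha
  · simp; ring
  · obtain ⟨m, rfl⟩ := Nat.exists_eq_add_of_le' ha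
    push_cast
    simp only [Pi.neg_apply, Pi.pow_apply]
    push_cast
    ring

/-- With `t = e^(-lη)`, the target `e^(-l|η|)` is `t` for `η ≥ 0` and `1/t` for `η ≤ 0`. The first
side uses `a ≥ 1`, the second `c > 0`. -/
lemma exists_norm_gumbel_le (hl : 0 < l) {a : ℕ} (ha : a ≠ 0) {c : ℝ} (hc : 0 < c) :
    ∃ C : ℝ, ∀ η, ‖gumbel l a c η‖ ≤ C * Real.exp (-(l * |η|)) := by
  refine ⟨max 1 ((a + 1).factorial / c ^ (a + 1)), fun η => ?_⟩
  set t := Real.exp (-l * η) with ht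
  have ht0 : 0 < t := Real.exp_pos _
  have hn : ‖gumbel l a c η‖ = t ^ a * Real.exp (-(c * t)) := by
    rw [gumbel, Complex.norm_real, Real.norm_of_nonneg (by positivity)]
  rw [hn]
  rcases le_total 0 η with hη | hη
  · have h1 : t ≤ 1 := by
      rw [ht, Real.exp_le_one_iff]
      nlinarith
    have h2 : t ^ a ≤ t := pow_le_of_le_one ht0.le h1 ha
    have h3 : Real.exp (-(c * t)) ≤ 1 := by
      rw [Real.exp_le_one_iff]; nlinarith [mul_pos hc ht0]
    have h4 : Real.exp (-(l * |η|)) = t := by rw [abs_of_nonneg hη, ht]; ring_nf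
    rw [h4]
    calc t ^ a * Real.exp (-(c * t)) ≤ t * 1 := by gcongr
      _ = 1 * t := by ring
      _ ≤ _ := by gcongr; exact le_max_left _ _
  · have h4 : Real.exp (-(l * |η|)) = t⁻¹ := by
      rw [abs_of_nonpos hη, ht, ← Real.exp_neg]; ring_nf
    rw [h4, ← div_eq_mul_inv, le_div_iff₀ ht0]
    calc t ^ a * Real.exp (-(c * t)) * t = t ^ (a + 1) * Real.exp (-(c * t)) := by ring
      _ ≤ _ := pow_mul_exp_neg_le (a + 1) hc ht0.le
      _ ≤ _ := le_max_right _ _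

/-- The span of the functions `gumbel l a c` with `a ≥ 1` and `c > 0`. -/
def gumbelSpan (l : ℝ) : Submodule ℂ (ℝ → ℂ) :=
  Submodule.span ℂ {g | ∃ (a : ℕ) (c : ℝ), a ≠ 0 ∧ 0 < c ∧ g = gumbel l a c}

/-- The functions that decay like `e^{-l |η|}` and have a derivative in `gumbelSpan l`. -/
def tame (l : ℝ) : Submodule ℂ (ℝ → ℂ) where
  carrier := {g | (∃ C : ℝ, ∀ η, ‖g η‖ ≤ C * Real.exp (-(l * |η|))) ∧
    ∃ g' ∈ gumbelSpan l, ∀ η, HasDerivAt g (g' η) η}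
  add_mem' := by
    rintro g h ⟨⟨C, hC⟩, g', hg', hd⟩ ⟨⟨E, hE⟩, h', hh', he⟩
    refine ⟨⟨C + E, fun η => ?_⟩, g' + h', add_mem hg' hh', fun η => (hd η).add (he η)⟩
    rw [add_mul]
    exact (norm_add_le _ _).trans (add_le_add (hC η) (hE η))
  zero_mem' := ⟨⟨0, by simp⟩, 0, zero_mem _, fun η => hasDerivAt_const η (0 : ℂ)⟩
  smul_mem' := by
    rintro z g ⟨⟨C, hC⟩, g', hg', hd⟩
    refine ⟨⟨‖z‖ * C, fun η => ?_⟩, z • g', Submodule.smul_mem _ z hg', fun η =>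
      (hd η).const_smul z⟩
    rw [Pi.smul_apply, norm_smul, mul_assoc]
    gcongr
    exact hC η

lemma gumbel_mem_gumbelSpan {a : ℕ} (ha : a ≠ 0) {c : ℝ} (hc : 0 < c) :
    gumbel l a c ∈ gumbelSpan l := Submodule.subset_span ⟨a, c, ha, hc, rfl⟩

lemma gumbel_mem_tame (hl : 0 < l) {a : ℕ} (ha : a ≠ 0) {c : ℝ} (hc : 0 < c) :
    gumbel l a c ∈ tame l := by
  refine ⟨exists_norm_gumbel_le hl ha hc,
    (-l * a : ℂ) • gumbel l a c + (c * l : ℂ) • gumbel l (a + 1) c,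
    add_mem (Submodule.smul_mem _ _ (gumbel_mem_gumbelSpan ha hc))
      (Submodule.smul_mem _ _ (gumbel_mem_gumbelSpan a.succ_ne_zero hc)), fun η => ?_⟩
  simpa using hasDerivAt_gumbel a c η

/-- Derivatives of tame functions lie in the span, hence are tame again. This closes the inductions
that give smoothness and the decay of all derivatives. -/
lemma gumbelSpan_le_tame (hl : 0 < l) : gumbelSpan l ≤ tame l := by
  rw [gumbelSpan, Submodule.span_le]
  rintro g ⟨a, c, ha, hc, rfl⟩
  exact gumbel_mem_tame hl ha hc

lemma contDiff_of_mem_tame (hl : 0 < l) (n : ℕ) : ∀ g ∈ tame l, ContDiff ℝ n g := by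
  induction n with
  | zero =>
    rintro g ⟨-, g', -, hd⟩
    exact contDiff_zero.2 (continuous_iff_continuousAt.2 fun η => (hd η).continuousAt)
  | succ n ih =>
    rintro g ⟨-, g', hg', hd⟩
    rw [Nat.cast_succ, contDiff_succ_iff_deriv]
    refine ⟨fun η => (hd η).differentiableAt, by simp, ?_⟩
    rw [show deriv g = g' from funext fun η => (hd η).deriv]
    exact ih _ (gumbelSpan_le_tame hl hg')

lemma exists_iteratedDeriv_le_of_mem_tame (hl : 0 < l) (n : ℕ) : ∀ g ∈ tame l,
    ∃ C : ℝ, ∀ η, ‖iteratedDeriv n g η‖ ≤ C * Real.exp (-(l * |η|)) := by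
  induction n with
  | zero =>
    rintro g ⟨hC, -⟩
    simpa using hC
  | succ n ih =>
    rintro g ⟨-, g', hg', hd⟩
    rw [iteratedDeriv_succ', show deriv g = g' from funext fun η => (hd η).deriv]
    exact ih _ (gumbelSpan_le_tame hl hg')

lemma pow_abs_mul_exp_le (hl : 0 < l) (k : ℕ) (η : ℝ) :
    |η| ^ k * Real.exp (-(l * |η|)) ≤ k.factorial / l ^ k :=
  pow_mul_exp_neg_le k hl (abs_nonneg η)

/-- Tame functions are Schwartz functions. -/
def schwartzOfTame (hl : 0 < l) (g : ℝ → ℂ) (hg : g ∈ tame l) : 𝓢(ℝ, ℂ) where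
  toFun := g
  smooth' := contDiff_infty.2 fun n => contDiff_of_mem_tame hl n g hg
  decay' k n := by
    obtain ⟨C, hC⟩ := exists_iteratedDeriv_le_of_mem_tame hl n g hg
    have hC0 : 0 ≤ C := by
      have := (norm_nonneg _).trans (hC 0)
      simpa using this
    refine ⟨C * (k.factorial / l ^ k), fun η => ?_⟩
    rw [norm_iteratedFDeriv_eq_norm_iteratedDeriv, Real.norm_eq_abs]
    calc _ ≤ |η| ^ k * (C * Real.exp (-(l * |η|))) := by gcongr; exact hC η
      _ = C * (|η| ^ k * Real.exp (-(l * |η|))) := by ring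
      _ ≤ _ := by gcongr; exact pow_abs_mul_exp_le hl k η

end Tame

/-! ### Laplace transform of the density and Poisson summation. -/

section Density

variable {p : ℝ}

/-- Each of the two functions tends to `1` as `η → ∞`, so neither is tame, but the difference is at
most `(c - 1) t e^(-t)`. This is what the case `k = 0` needs. -/
lemma gumbel_one_sub_mem_tame {l : ℝ} (hl : 0 < l) {c : ℝ} (hc : 1 ≤ c) :
    gumbel l 0 1 - gumbel l 0 c ∈ tame l := by
  have hc0 : 0 < c := by linarith
  obtain ⟨C, hC⟩ := exists_norm_gumbel_le hl one_ne_zero one_pos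
  refine ⟨⟨(c - 1) * C, fun η => ?_⟩,
    (l : ℂ) • gumbel l 1 1 - (c * l : ℂ) • gumbel l 1 c, sub_mem
      (Submodule.smul_mem _ _ (gumbel_mem_gumbelSpan one_ne_zero one_pos))
      (Submodule.smul_mem _ _ (gumbel_mem_gumbelSpan one_ne_zero hc0)), fun η => ?_⟩
  · rw [mul_assoc]
    refine le_trans ?_ (mul_le_mul_of_nonneg_left (hC η) (by linarith))
    simp only [gumbel, Pi.sub_apply, pow_zero, one_mul, pow_one]
    rw [← Complex.ofReal_sub, Complex.norm_real, Complex.norm_real]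
    set t := Real.exp (-l * η)
    have ht : 0 < t := Real.exp_pos _
    have h1 : Real.exp (-(c * t)) = Real.exp (-t) * Real.exp (-((c - 1) * t)) := by
      rw [← Real.exp_add]; congr 1; ring
    have h2 : Real.exp (-((c - 1) * t)) ≤ 1 := by
      rw [Real.exp_le_one_iff]; nlinarith
    have h3 := Real.one_sub_le_exp_neg ((c - 1) * t)
    have h4 := Real.exp_pos (-t)
    rw [Real.norm_of_nonneg (by rw [h1]; nlinarith), Real.norm_of_nonneg (by positivity), h1]
    nlinarith
  · have := (hasDerivAt_gumbel (l := l) 0 1 η).sub (hasDerivAt_gumbel (l := l) 0 c η)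
    simpa using this

lemma f_mem_tame (hp0 : 0 < p) (hp1 : p < 1) (b k : ℕ) :
    (fun η => (f p b k η : ℂ)) ∈ tame (L p) := by
  have hL := L_pos hp0 hp1
  have hq : 0 < 1 - p := by linarith
  have hpois : ∀ (m : ℕ) (c : ℝ), (fun η : ℝ => (poisProb m (Real.exp (-L p * η) / c) : ℂ)) =
      ((1 / c) ^ m / m.factorial : ℂ) • gumbel (L p) m (1 / c) := by
    intro m c
    ext η
    simp only [poisProb, gumbel, Pi.smul_apply, smul_eq_mul]
    have : Real.exp (-(Real.exp (-L p * η) / c)) = Real.exp (-(1 / c * Real.exp (-L p * η))) := by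
      congr 1; ring
    rw [this]
    push_cast
    ring
  have hpois1 : ∀ m : ℕ, (fun η : ℝ => (poisProb m (Real.exp (-L p * η)) : ℂ)) =
      ((1 / 1) ^ m / m.factorial : ℂ) • gumbel (L p) m 1 := by
    intro m
    have := hpois m 1
    simpa using this
  have hmem : ∀ (m : ℕ) (c : ℝ), m ≠ 0 → 0 < c →
      (fun η : ℝ => (poisProb m (Real.exp (-L p * η) / c) : ℂ)) ∈ tame (L p) := by
    intro m c hm hc
    rw [hpois]
    exact Submodule.smul_mem _ _ (gumbel_mem_tame hL hm (by positivity))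
  have hf : (fun η => (f p b k η : ℂ)) = (fun η : ℝ => (poisProb k (Real.exp (-L p * η)) : ℂ)) -
      ∑ i ∈ Finset.range (b - k + 1), (((k + i).choose k * (1 - p) ^ k * p ^ i : ℝ) : ℂ) •
        (fun η : ℝ => (poisProb (k + i) (Real.exp (-L p * η) / (1 - p)) : ℂ)) := by
    ext η
    rw [f_eq hp1]
    simp only [Pi.sub_apply, Finset.sum_apply, Pi.smul_apply, smul_eq_mul]
    push_cast
    rfl
  rw [hf]
  rcases eq_or_ne k 0 with rfl | hk
  -- The summand `i = 0` is isolated in order to pair it with the leading term; all other summands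
  -- have positive index and are tame individually.
  · rw [Finset.sum_range_succ', add_comm, ← sub_sub]
    refine sub_mem ?_ (sum_mem fun i _ => Submodule.smul_mem _ _
      (hmem _ _ (by omega) hq))
    have := gumbel_one_sub_mem_tame hL (c := 1 / (1 - p)) (by
      rw [le_div_iff₀ hq]; linarith)
    rw [hpois, hpois1]
    simpa using this
  · refine sub_mem ?_ (sum_mem fun i _ => Submodule.smul_mem _ _ (hmem _ _ (by omega) hq))
    have := hmem k 1 hk one_pos
    simpa using this

lemma exists_f_le_exp (hp0 : 0 < p) (hp1 : p < 1) (b k : ℕ) :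
    ∃ C : ℝ, ∀ η, f p b k η ≤ C * Real.exp (-(L p * |η|)) := by
  obtain ⟨⟨C, hC⟩, -⟩ := f_mem_tame hp0 hp1 b k
  refine ⟨C, fun η => ?_⟩
  have := hC η
  rw [Complex.norm_real] at this
  exact (le_abs_self _).trans this

lemma continuous_f (b k : ℕ) : Continuous (f p b k) := by
  unfold f; fun_prop

/-- The measure with density `f`. -/
noncomputable def fMeasure (p : ℝ) (b k : ℕ) : Measure ℝ :=
  volume.withDensity fun η => ENNReal.ofReal (f p b k η)

lemma integral_fMeasure (hp0 : 0 < p) (hp1 : p < 1) (b k : ℕ) (g : ℝ → ℂ) :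
    ∫ η, g η ∂(fMeasure p b k) = ∫ η, g η * (f p b k η : ℂ) := by
  rw [fMeasure, integral_withDensity_eq_integral_toReal_smul
    (continuous_f b k).measurable.ennreal_ofReal (by simp)]
  refine integral_congr_ae (ae_of_all _ fun η => ?_)
  simp only [ENNReal.toReal_ofReal (f_nonneg hp0 hp1 b k η), Complex.real_smul, mul_comm]

/-- Viewing `φ` as a moment generating function gives its holomorphy and differentiation under the
integral sign. -/
lemma phi_eq_complexMGF (hp0 : 0 < p) (hp1 : p < 1) (b k : ℕ) :
    φ p b k = complexMGF id (fMeasure p b k) := by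
  ext α
  rw [φ, complexMGF, integral_fMeasure hp0 hp1]
  rfl

/-- Since `f` is bounded by a multiple of `e^(-L|η|)`, the transform exists in the open strip of
half-width `L` around the imaginary axis. -/
lemma mem_interior_integrableExpSet (hp0 : 0 < p) (hp1 : p < 1) (b k : ℕ) {v : ℝ}
    (hv : |v| < L p) : v ∈ interior (integrableExpSet id (fMeasure p b k)) := by
  refine interior_mono (s := Set.Ioo (-L p) (L p)) ?_ ?_
  · intro v hv
    rw [integrableExpSet, Set.mem_ofPred_eq, fMeasure,
      integrable_withDensity_iff_integrable_smul' (continuous_f b k).measurable.ennreal_ofReal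
        (by simp)]
    simp only [ENNReal.toReal_ofReal (f_nonneg hp0 hp1 b k _), id, smul_eq_mul]
    obtain ⟨C, hC⟩ := exists_f_le_exp hp0 hp1 b k
    have hpos : 0 < L p - |v| := by rw [sub_pos, abs_lt]; exact hv
    refine ((integrable_exp_neg_mul_abs hpos).const_mul C).mono' ?_ (ae_of_all _ fun η => ?_)
    · exact ((continuous_f b k).mul (by fun_prop)).aestronglyMeasurable
    · have hf0 := f_nonneg hp0 hp1 b k η
      have h0 : 0 ≤ C := by
        have := (f_nonneg hp0 hp1 b k 0).trans (hC 0)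
        simpa using this
      rw [Real.norm_of_nonneg (by positivity)]
      calc _ ≤ (C * Real.exp (-(L p * |η|))) * Real.exp (|v| * |η|) := by
            refine mul_le_mul (hC η) ?_ (Real.exp_pos _).le (by positivity)
            rw [Real.exp_le_exp, ← abs_mul]
            exact le_abs_self _
        _ = _ := by rw [mul_assoc, ← Real.exp_add]; ring_nf
  · rw [isOpen_Ioo.interior_eq]
    exact abs_lt.1 hv

lemma iteratedDeriv_phi (hp0 : 0 < p) (hp1 : p < 1) (b k j : ℕ) {z : ℂ} (hz : |z.re| < L p) :
    iteratedDeriv j (φ p b k) z = ∫ η : ℝ, (η : ℂ) ^ j * Complex.exp (z * η) * (f p b k η : ℂ) := by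
  rw [phi_eq_complexMGF hp0 hp1,
    iteratedDeriv_complexMGF (mem_interior_integrableExpSet hp0 hp1 b k hz),
    integral_fMeasure hp0 hp1]
  rfl

lemma analyticAt_phi (hp0 : 0 < p) (hp1 : p < 1) (b k : ℕ) {z : ℂ} (hz : |z.re| < L p) :
    AnalyticAt ℂ (φ p b k) z := by
  rw [phi_eq_complexMGF hp0 hp1]
  exact analyticAt_complexMGF (mem_interior_integrableExpSet hp0 hp1 b k hz)

/-- The Schwartz function `η^j f(k, η)`. -/
noncomputable def momentSchwartz (hp0 : 0 < p) (hp1 : p < 1) (b k j : ℕ) : 𝓢(ℝ, ℂ) :=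
  SchwartzMap.smulLeftCLM ℂ (fun η : ℝ => η ^ j)
    (schwartzOfTame (L_pos hp0 hp1) _ (f_mem_tame hp0 hp1 b k))

lemma momentSchwartz_apply (hp0 : 0 < p) (hp1 : p < 1) (b k j : ℕ) (η : ℝ) :
    momentSchwartz hp0 hp1 b k j η = (η : ℂ) ^ j * (f p b k η : ℂ) := by
  rw [momentSchwartz, SchwartzMap.smulLeftCLM_apply_apply (by fun_prop), Complex.real_smul]
  push_cast
  rfl

lemma neg_L_mul_chi (hp0 : 0 < p) (hp1 : p < 1) (l : ℤ) :
    -(L p : ℂ) * χ p l = -(2 * Real.pi * l * Complex.I) := by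
  have : (L p : ℂ) ≠ 0 := by exact_mod_cast (L_pos hp0 hp1).ne'
  rw [χ]
  field_simp

/-- Because `-L χ_l = -2πil`, the `j`-th derivative of the Laplace transform there is the Fourier
transform of `η^j f` at the integer `l`. -/
lemma wTerm_eq_fourier (hp0 : 0 < p) (hp1 : p < 1) (b j k : ℕ) (x : ℝ) (l : ℤ) :
    wTerm p b j k x l = 𝓕 (momentSchwartz hp0 hp1 b k j : ℝ → ℂ) l *
      fourier l ((-x : ℝ) : UnitAddCircle) := by
  rw [wTerm, neg_L_mul_chi hp0 hp1, iteratedDeriv_phi hp0 hp1]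
  · congr 1
    · rw [Real.fourier_real_eq_integral_exp_smul]
      refine integral_congr_ae (ae_of_all _ fun η => ?_)
      simp only [momentSchwartz_apply, smul_eq_mul]
      have : -(2 * (Real.pi : ℂ) * l * Complex.I) * η =
        ((-2 * Real.pi * η * (l : ℝ) : ℝ) : ℂ) * Complex.I := by push_cast; ring
      rw [this]
      ring
    · rw [fourier_coe_apply]
      congr 1
      push_cast
      ring
  · have : (-(2 * (Real.pi : ℂ) * l * Complex.I)).re = 0 := by simp
    rw [this, abs_zero]
    exact L_pos hp0 hp1

lemma summable_int_abs_rpow_neg_two : Summable fun l : ℤ => |(l : ℝ)| ^ (-2 : ℝ) :=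
  Real.summable_abs_int_rpow one_lt_two

lemma summable_wTerm (hp0 : 0 < p) (hp1 : p < 1) (b j k : ℕ) (x : ℝ) :
    Summable fun l : ℤ => wTerm p b j k x l := by
  have h := (𝓕 (momentSchwartz hp0 hp1 b k j)).isBigO_cocompact_rpow (-2)
  have h2 := summable_of_isBigO summable_int_abs_rpow_neg_two
    (h.comp_tendsto Int.tendsto_coe_cofinite)
  refine Summable.of_norm_bounded h2.norm fun l => ?_
  rw [wTerm_eq_fourier hp0 hp1, norm_mul]
  have : ‖fourier l ((-x : ℝ) : UnitAddCircle)‖ ≤ 1 := by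
    rw [fourier_apply, Circle.norm_coe]
  refine (mul_le_of_le_one_right (norm_nonneg _) this).trans (le_of_eq ?_)
  simp [SchwartzMap.fourier_coe]

/-- Poisson summation: the sum of the periodised density is the Fourier series. -/
theorem hasSum_moment (hp0 : 0 < p) (hp1 : p < 1) (b j k : ℕ) (x : ℝ) :
    HasSum (fun d : ℤ => (((d - x) ^ j * f p b k (d - x) : ℝ) : ℂ))
      (mTilde p b j k + wTilde p b j k x) := by
  have hsum : Summable fun d : ℤ => (((d - x) ^ j * f p b k (d - x) : ℝ) : ℂ) := by
    rw [Complex.summable_ofReal]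
    obtain ⟨C, hC⟩ := exists_f_le_exp hp0 hp1 b k
    obtain ⟨K, hK⟩ := exists_tsum_pow_mul_exp_le (L_pos hp0 hp1) j
    refine ((hK x).1.mul_left C).of_norm_bounded fun d => ?_
    rw [norm_mul, norm_pow, Real.norm_eq_abs, Real.norm_of_nonneg (f_nonneg hp0 hp1 b k _),
      mul_left_comm]
    gcongr
    exact hC _
  have h := SchwartzMap.tsum_eq_tsum_fourier (momentSchwartz hp0 hp1 b k j) (-x)
  rw [hsum.hasSum_iff]
  have h1 : ∀ d : ℤ, momentSchwartz hp0 hp1 b k j (-x + d) =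
      (((d - x) ^ j * f p b k (d - x) : ℝ) : ℂ) := by
    intro d
    rw [momentSchwartz_apply]
    have : -x + (d : ℝ) = d - x := by ring
    rw [this]; push_cast; ring
  simp only [h1] at h
  rw [h]
  have h2 : ∀ l : ℤ, 𝓕 (momentSchwartz hp0 hp1 b k j) (l : ℝ) *
      fourier l ((-x : ℝ) : UnitAddCircle) = wTerm p b j k x l := by
    intro l
    rw [wTerm_eq_fourier hp0 hp1, SchwartzMap.fourier_coe]
  simp only [h2]
  -- The zeroth Fourier coefficient is the nonperiodic part, as `χ_0 = 0`.
  have h0 : wTerm p b j k x 0 = mTilde p b j k := by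
    simp [wTerm, mTilde, χ]
  have hs := summable_wTerm hp0 hp1 b j k x
  rw [wTilde, ← h0, ← hs.tsum_subtype_add_tsum_subtype_compl {0},
    tsum_singleton 0 (fun l => wTerm p b j k x l)]
  rfl

end Density

end AdaptiveSampling

/-! ### Comparison of the exact moments with the limit. -/

namespace AdaptiveSampling

variable {p : ℝ}

lemma exp_neg_L_mul_sub_logb (hp0 : 0 < p) (hp1 : p < 1) {n : ℕ} (hn : 0 < n) (y : ℝ) :
    Real.exp (-L p * (y - Real.logb (Q p) n)) = n * Real.exp (-L p * y) := by
  have hL := (L_pos hp0 hp1).ne'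
  have h : -L p * (y - Real.logb (Q p) n) = Real.log n + -L p * y := by
    rw [Real.logb, ← L]
    field_simp
    ring
  rw [h, Real.exp_add, Real.exp_log (by exact_mod_cast hn)]

lemma exp_neg_L_mul_natCast (hp1 : p < 1) (d : ℕ) : Real.exp (-L p * d) = (1 - p) ^ d := by
  rw [mul_comm, Real.exp_nat_mul, exp_neg_L hp1]

/-- The rate `1/4`, below the rate `1/2` of `exists_f_le`, leaves room for one more factor `t` in
`exists_f_nonpos_le`. -/
lemma exists_mul_exp_le (hp0 : 0 < p) (hp1 : p < 1) : ∃ C : ℝ, 0 ≤ C ∧ ∀ η : ℝ,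
    Real.exp (-L p * η) * Real.exp (-(1 / 4 * Real.exp (-L p * η))) ≤
      C * Real.exp (-(L p * |η|)) := by
  obtain ⟨C, hC⟩ := exists_norm_gumbel_le (L_pos hp0 hp1) one_ne_zero
    (by norm_num : (0 : ℝ) < 1 / 4)
  refine ⟨C, ?_, fun η => ?_⟩
  · have := (norm_nonneg _).trans (hC 0)
    simpa using this
  · have := hC η
    rwa [gumbel, pow_one, Complex.norm_real, Real.norm_of_nonneg (by positivity)] at this

/-- The law of depth and size is close to its limiting density. -/
lemma exists_abs_law_sub_f_le (hp0 : 0 < p) (hp1 : p < 1) {b k : ℕ} (hk : k ≤ b) :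
    ∃ C : ℝ, 0 ≤ C ∧ ∀ n : ℕ, b < n → ∀ d : ℕ,
      |binProb n k ((1 - p) ^ (d + 1)) -
        ∑ i ∈ Finset.range (b - k + 1), ((k + i).choose k * (1 - p) ^ k * p ^ i) *
          binProb n (k + i) ((1 - p) ^ d) -
        f p b k ((d + 1 : ℕ) - Real.logb (Q p) n)| ≤
      C / n * Real.exp (-(L p * |((d + 1 : ℕ) : ℝ) - Real.logb (Q p) n|)) := by
  have hq : 0 < 1 - p := by linarith
  choose C hC h using exists_abs_binProb_sub_poisProb_le
  obtain ⟨K, hK, hKb⟩ := exists_mul_exp_le hp0 hp1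
  refine ⟨(C k + ∑ i ∈ Finset.range (b - k + 1), ((k + i).choose k * (1 - p) ^ k * p ^ i) *
    (C (k + i) / (1 - p))) * K, mul_nonneg (add_nonneg (hC k) (Finset.sum_nonneg fun i _ =>
      mul_nonneg (by positivity) (div_nonneg (hC _) hq.le))) hK, fun n hn d => ?_⟩
  have hn0 : 0 < n := by omega
  have hn0' : (0 : ℝ) < n := by exact_mod_cast hn0
  set η := ((d + 1 : ℕ) : ℝ) - Real.logb (Q p) n with hη
  set t := Real.exp (-L p * η) with ht
  have ht0 : 0 < t := Real.exp_pos _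
  have htu : n * (1 - p) ^ (d + 1) = t := by
    rw [ht, hη, exp_neg_L_mul_sub_logb hp0 hp1 hn0, exp_neg_L_mul_natCast hp1]
  have htv : n * (1 - p) ^ d = t / (1 - p) := by
    rw [← htu, pow_succ]; field_simp
  have hψ := hKb η
  rw [← ht] at hψ
  have he0 := h k n hn0 (by omega) ((1 - p) ^ (d + 1)) (by positivity)
    (pow_le_one₀ hq.le (by linarith))
  rw [htu] at he0
  have hexp : Real.exp (-(1 / 2 * t)) ≤ Real.exp (-(1 / 4 * t)) := by
    rw [Real.exp_le_exp]; linarith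
  have he0' : |binProb n k ((1 - p) ^ (d + 1)) - poisProb k t| ≤
      C k / n * (t * Real.exp (-(1 / 4 * t))) := by
    have := hC k
    exact he0.trans (by gcongr)
  have hei : ∀ i ∈ Finset.range (b - k + 1),
      |binProb n (k + i) ((1 - p) ^ d) - poisProb (k + i) (t / (1 - p))| ≤
        (C (k + i) / (1 - p)) / n * (t * Real.exp (-(1 / 4 * t))) := by
    intro i hi
    rw [Finset.mem_range] at hi
    have := h (k + i) n hn0 (by omega) ((1 - p) ^ d) (by positivity)
      (pow_le_one₀ hq.le (by linarith))
    rw [htv] at this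
    have hCi := hC (k + i)
    have hle : t ≤ t / (1 - p) := le_div_self ht0.le hq (by linarith)
    have hexp' : Real.exp (-(1 / 2 * (t / (1 - p)))) ≤ Real.exp (-(1 / 4 * t)) := by
      rw [Real.exp_le_exp]; linarith
    calc _ ≤ _ := this
      _ ≤ C (k + i) / n * (t / (1 - p) * Real.exp (-(1 / 4 * t))) := by gcongr
      _ = _ := by ring
  rw [f_eq hp1, ← ht]
  have heq : ∀ a a' s s' : ℝ, a - s - (a' - s') = (a - a') - (s - s') := by intros; ring
  rw [heq, ← Finset.sum_sub_distrib]
  simp only [← mul_sub]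
  refine (abs_sub _ _).trans ?_
  refine (add_le_add he0' (Finset.abs_sum_le_sum_abs _ _)).trans ?_
  have hsum : ∑ i ∈ Finset.range (b - k + 1), |((k + i).choose k * (1 - p) ^ k * p ^ i) *
      (binProb n (k + i) ((1 - p) ^ d) - poisProb (k + i) (t / (1 - p)))| ≤
      ∑ i ∈ Finset.range (b - k + 1), ((k + i).choose k * (1 - p) ^ k * p ^ i) *
        ((C (k + i) / (1 - p)) / n * (t * Real.exp (-(1 / 4 * t)))) := by
    refine Finset.sum_le_sum fun i hi => ?_
    rw [abs_mul, abs_of_nonneg (by positivity : 0 ≤ ((k + i).choose k * (1 - p) ^ k * p ^ i : ℝ))]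
    gcongr
    exact hei i hi
  refine (add_le_add le_rfl hsum).trans ?_
  have hcol : C k / n * (t * Real.exp (-(1 / 4 * t))) +
      ∑ i ∈ Finset.range (b - k + 1), ((k + i).choose k * (1 - p) ^ k * p ^ i) *
        ((C (k + i) / (1 - p)) / n * (t * Real.exp (-(1 / 4 * t)))) =
      (C k + ∑ i ∈ Finset.range (b - k + 1), ((k + i).choose k * (1 - p) ^ k * p ^ i) *
        (C (k + i) / (1 - p))) / n * (t * Real.exp (-(1 / 4 * t))) := by
    rw [add_div, add_mul, Finset.sum_div, Finset.sum_mul]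
    congr 1
    refine Finset.sum_congr rfl fun i _ => ?_
    ring
  rw [hcol, mul_div_right_comm, mul_assoc]
  refine mul_le_mul_of_nonneg_left hψ (div_nonneg (add_nonneg (hC k) (Finset.sum_nonneg fun i _ =>
      mul_nonneg (by positivity) (div_nonneg (hC _) hq.le))) hn0'.le)

/-- The limiting density is negligible at nonpositive depths. -/
lemma exists_f_nonpos_le (hp0 : 0 < p) (hp1 : p < 1) (b k : ℕ) :
    ∃ C : ℝ, 0 ≤ C ∧ ∀ n : ℕ, 0 < n → ∀ d : ℤ, d ≤ 0 →
      f p b k (d - Real.logb (Q p) n) ≤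
        C / n * Real.exp (-(L p * |(d : ℝ) - Real.logb (Q p) n|)) := by
  obtain ⟨C, hC, h⟩ := exists_f_le hp0 hp1 b k
  obtain ⟨K, hK, hKb⟩ := exists_mul_exp_le hp0 hp1
  obtain ⟨E, hE, hEb⟩ := exists_pow_succ_mul_exp_neg_le 1 (by norm_num : (1 / 4 : ℝ) < 1 / 2)
  refine ⟨C * E * K, by positivity, fun n hn d hd => ?_⟩
  have hn0' : (0 : ℝ) < n := by exact_mod_cast hn
  refine (h _).trans ?_
  set η := (d : ℝ) - Real.logb (Q p) n with hη
  set t := Real.exp (-L p * η) with ht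
  have ht0 : 0 < t := Real.exp_pos _
  -- For `d ≤ 0` one has `t = n q^d ≥ n`, so inserting an extra factor `t / n ≥ 1` produces the
  -- `1/n`.
  have hnt : n ≤ t := by
    rw [ht, hη, exp_neg_L_mul_sub_logb hp0 hp1 hn]
    refine le_mul_of_one_le_right hn0'.le (Real.one_le_exp ?_)
    have : (d : ℝ) ≤ 0 := by exact_mod_cast hd
    nlinarith [L_pos hp0 hp1]
  have h1 : t * Real.exp (-(1 / 2 * t)) ≤ (t ^ (1 + 1) * Real.exp (-(1 / 2 * t))) / n := by
    rw [le_div_iff₀ hn0']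
    calc _ ≤ t * Real.exp (-(1 / 2 * t)) * t := by gcongr
      _ = _ := by ring
  calc C * (t * Real.exp (-(1 / 2 * t)))
      ≤ C * ((E * (K * Real.exp (-(L p * |η|)))) / n) := by
        gcongr
        refine h1.trans ?_
        rw [div_le_div_iff_of_pos_right hn0']
        exact (hEb t ht0.le).trans (mul_le_mul_of_nonneg_left (hKb η) hE)
    _ = _ := by ring

section Asymptotics

variable {Ω : Type*} [MeasurableSpace Ω] {P : Measure Ω} [IsProbabilityMeasure P]
  {bit : ℕ → ℕ → Ω → Bool} {b : ℕ} {S : ℕ → List ℕ} {D R : ℕ → Ω → ℕ}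

/-- The asymptotics of the moments of the depth, jointly with the size. -/
theorem exists_norm_moment_sub_le (hp0 : 0 < p) (hp1 : p < 1)
    (hm : ∀ x m, Measurable (bit x m))
    (hi : iIndepFun (fun xm : ℕ × ℕ => bit xm.1 xm.2) P)
    (hp : ∀ x m, P.real {ω | bit x m ω = true} = p)
    (hS : ∀ n, (S n).toFinset = Finset.range n)
    (hD : ∀ n ω, D n ω = finalDepth b (fun x m => bit x m ω) (S n))
    (hR : ∀ n ω, R n ω = finalSize b (fun x m => bit x m ω) (S n)) (j : ℕ) {k : ℕ} (hk : k ≤ b) :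
    ∃ C : ℝ, ∀ n : ℕ, b < n →
      ‖((∫ ω in {ω | R n ω = k}, ((D n ω : ℝ) - Real.logb (Q p) n) ^ j ∂P : ℝ) : ℂ) -
        (mTilde p b j k + wTilde p b j k (Real.logb (Q p) n))‖ ≤ C / n := by
  obtain ⟨C1, hC1, h1⟩ := exists_abs_law_sub_f_le hp0 hp1 hk
  obtain ⟨C2, hC2, h2⟩ := exists_f_nonpos_le hp0 hp1 b k
  obtain ⟨K, hK⟩ := exists_tsum_pow_mul_exp_le (L_pos hp0 hp1) j
  refine ⟨max C1 C2 * K, fun n hn => ?_⟩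
  have hn0 : 0 < n := by omega
  set x := Real.logb (Q p) n with hx
  have hC0 : 0 ≤ max C1 C2 / n := div_nonneg (hC1.trans (le_max_left _ _)) (Nat.cast_nonneg n)
  have hs1 := hasSum_setIntegral_pow_depth_sub hp0 hp1 hm hi hp (hS n) (hD n) (hR n) x j k
  -- The law of the depth is extended by zero to all integers, to be compared termwise with the
  -- two-sided sum from Poisson summation.
  obtain ⟨A, hA⟩ : ∃ A : ℤ → ℝ, A = fun d : ℤ =>
    if 0 ≤ d then P.real {ω | D n ω = d.toNat ∧ R n ω = k} else 0 := ⟨_, rfl⟩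
  have hs2 : HasSum (fun d : ℤ => ((d : ℝ) - x) ^ j * A d)
      (∫ ω in {ω | R n ω = k}, ((D n ω : ℝ) - x) ^ j ∂P) := by
    rw [← Nat.cast_injective.hasSum_iff (g := ((↑) : ℕ → ℤ))]
    · refine hs1.congr_fun fun d => ?_
      simp [hA]
    · intro d hd
      have : ¬ 0 ≤ d := fun h => hd ⟨d.toNat, Int.toNat_of_nonneg h⟩
      simp [hA, this]
  have hs3 := hasSum_moment hp0 hp1 b j k x
  have hs4 := ((Complex.hasSum_ofReal.2 hs2).sub hs3)
  have hle : ∀ d : ℤ, |A d - f p b k (d - x)| ≤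
      max C1 C2 / n * Real.exp (-(L p * |(d : ℝ) - x|)) := by
    intro d
    rcases le_or_gt d 0 with hd | hd
    · have hA0 : A d = 0 := by
        rw [hA]
        simp only
        split_ifs with h
        -- Depth `0` has probability zero because `n > b` keys cannot all fit, so the formula for
        -- positive depths `m + 1` covers every remaining case.
        · have hd0 : d = 0 := le_antisymm hd h
          subst hd0
          rw [measureReal_eq_zero_iff]
          refine measure_mono_null (t := {ω | ¬ 0 < D n ω}) (fun ω hω => ?_)
            (ae_depth_pos hp0 hp1 hm hi hp (hS n) (hD n) (hR n) hn)
          have : D n ω = 0 := by simpa using hω.1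
          simp [this]
        · rfl
      rw [hA0, zero_sub, abs_neg, abs_of_nonneg (f_nonneg hp0 hp1 b k _)]
      refine (h2 n hn0 d hd).trans ?_
      gcongr
      exact le_max_right _ _
    · obtain ⟨m, rfl⟩ : ∃ m : ℕ, d = ((m + 1 : ℕ) : ℤ) := ⟨(d - 1).toNat, by omega⟩
      have hAm : A ((m + 1 : ℕ) : ℤ) = P.real {ω | D n ω = m + 1 ∧ R n ω = k} := by
        rw [hA]
        simp only [Int.toNat_natCast, if_pos (Int.natCast_nonneg _)]
      rw [hAm, real_depth_size hp0 hp1 hm hi hp (hS n) (hD n) (hR n) m hk, Int.cast_natCast]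
      refine (h1 n hn m).trans ?_
      gcongr
      exact le_max_left _ _
  rw [← hs4.tsum_eq]
  have hbound : ∀ d : ℤ, ‖((((d : ℝ) - x) ^ j * A d : ℝ) : ℂ) -
      (((d - x) ^ j * f p b k (d - x) : ℝ) : ℂ)‖ ≤
      max C1 C2 / n * (|(d : ℝ) - x| ^ j * Real.exp (-(L p * |(d : ℝ) - x|))) := by
    intro d
    rw [← Complex.ofReal_sub, ← mul_sub, Complex.norm_real, norm_mul, norm_pow, Real.norm_eq_abs,
      Real.norm_eq_abs, mul_left_comm]
    gcongr
    exact hle d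
  refine (tsum_of_norm_bounded ((hK x).1.hasSum.mul_left _) hbound).trans ?_
  rw [div_mul_eq_mul_div]
  have := (hK x).2
  have := hC1.trans (le_max_left C1 C2)
  gcongr

end Asymptotics

end AdaptiveSampling

/-! ### The value of the trigamma function at `1`. -/

namespace AdaptiveSampling

section ExpIntegral

/-- The integral `∫₀¹ x^n e^{zx} dx`. -/
noncomputable def unitExp (n : ℕ) (z : ℂ) : ℂ :=
  ∫ x, (x : ℂ) ^ n * Complex.exp (z * x) ∂(volume.restrict (Set.Ioc (0 : ℝ) 1))

lemma hasDerivAt_unitExp (n : ℕ) (z : ℂ) : HasDerivAt (unitExp n) (unitExp (n + 1) z) z := by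
  have hset : integrableExpSet id (volume.restrict (Set.Ioc (0 : ℝ) 1)) = Set.univ := by
    refine Set.eq_univ_of_forall fun t => ?_
    have hc : Continuous fun x : ℝ => Real.exp (t * id x) := by
      simp only [id]; fun_prop
    exact hc.integrableOn_Ioc
  have h := hasDerivAt_integral_pow_mul_exp (X := id) (μ := volume.restrict (Set.Ioc (0 : ℝ) 1))
    (z := z) (by rw [hset, interior_univ]; trivial) n
  exact h

lemma unitExp_zero_right (n : ℕ) : unitExp n 0 = 1 / (n + 1) := by
  rw [unitExp]
  simp only [zero_mul, Complex.exp_zero, mul_one]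
  rw [← intervalIntegral.integral_of_le zero_le_one]
  have : ∀ x : ℝ, (x : ℂ) ^ n = ((x ^ n : ℝ) : ℂ) := fun x => by push_cast; rfl
  simp only [this]
  rw [intervalIntegral.integral_ofReal, integral_pow]
  push_cast
  simp

/-- Makes `unitExp 0` the entire version of `(e^z - 1)/z`. It removes the singularity at `0` both in
the reflection formula and in `φ(0, ·)`, and its derivatives at `0` are explicit. -/
lemma mul_unitExp_zero (z : ℂ) : z * unitExp 0 z = Complex.exp z - 1 := by
  rcases eq_or_ne z 0 with rfl | hz
  · simp
  rw [unitExp]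
  simp only [pow_zero, one_mul]
  rw [← intervalIntegral.integral_of_le zero_le_one, integral_exp_mul_complex hz]
  field_simp
  simp

end ExpIntegral

section Gamma

open Complex

lemma hasDerivAt_Gamma_digamma {s : ℂ} (hs : ∀ m : ℕ, s ≠ -m) :
    HasDerivAt Gamma (digamma s * Gamma s) s := by
  have h := (differentiableAt_Gamma s hs).hasDerivAt
  rw [digamma_def, logDeriv_apply, div_mul_cancel₀ _ (Gamma_ne_zero hs)]
  exact h

/-- The excluded points are the zeros of the entire function `1/Γ`; in Lean they are also the points
where `Gamma` takes the default value `0`. -/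
lemma isOpen_ne_neg_natCast : IsOpen {s : ℂ | ∀ m : ℕ, s ≠ -m} := by
  have : {s : ℂ | ∀ m : ℕ, s ≠ -m} = {s : ℂ | Gamma s = 0}ᶜ := by
    ext s
    simp [Gamma_eq_zero_iff]
  rw [this]
  have hc : IsClosed {s : ℂ | (Gamma s)⁻¹ = 0} :=
    isClosed_eq differentiable_one_div_Gamma.continuous continuous_const
  simp only [inv_eq_zero] at hc
  exact hc.isOpen_compl

lemma hasDerivAt_digamma {s : ℂ} (hs : ∀ m : ℕ, s ≠ -m) :
    HasDerivAt digamma (trigamma s) s := by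
  have hd : DifferentiableOn ℂ Gamma {s : ℂ | ∀ m : ℕ, s ≠ -m} := fun z hz =>
    (differentiableAt_Gamma z hz).differentiableWithinAt
  have ha : AnalyticAt ℂ Gamma s := hd.analyticAt (isOpen_ne_neg_natCast.mem_nhds hs)
  have : DifferentiableAt ℂ digamma s :=
    ha.deriv.differentiableAt.div ha.differentiableAt (Gamma_ne_zero hs)
  exact this.hasDerivAt

lemma ne_neg_natCast_of_re_pos {s : ℂ} (hs : 0 < s.re) (m : ℕ) : s ≠ -m := by
  rintro rfl
  simp only [neg_re, natCast_re, Left.neg_pos_iff] at hs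
  exact absurd hs (by simp)

/-- The reflection formula in terms of `unitExp`. -/
lemma Gamma_mul_Gamma_mul_unitExp {s : ℂ} (hs : ‖s‖ < 1) :
    Gamma (1 + s) * Gamma (1 - s) * (exp (-(Real.pi * I * s)) * unitExp 0 (2 * Real.pi * I * s)) =
      1 := by
  rcases eq_or_ne s 0 with rfl | h0
  · simp [unitExp_zero_right]
  have hpi : (Real.pi : ℂ) ≠ 0 := by exact_mod_cast Real.pi_ne_zero
  have hsin : sin (Real.pi * s) ≠ 0 := by
    rw [Ne, Complex.sin_eq_zero_iff]
    rintro ⟨k, hk⟩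
    have hk' : s = k := by
      rw [mul_comm] at hk; exact mul_right_cancel₀ hpi hk
    rw [hk', norm_intCast] at hs
    have : |k| < 1 := by exact_mod_cast hs
    rw [Int.abs_lt_one_iff] at this
    rw [this] at hk'
    exact h0 (by simpa using hk')
  have hu := mul_unitExp_zero (2 * Real.pi * I * s)
  -- With `u = πis` this is `e^(-u)(e^(2u) - 1)/(2u) = sinh(u)/u`.
  have hE : exp (-(Real.pi * I * s)) * unitExp 0 (2 * Real.pi * I * s) =
      sin (Real.pi * s) / (Real.pi * s) := by
    have h2 : exp (2 * Real.pi * I * s) = exp (Real.pi * I * s) * exp (Real.pi * I * s) := by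
      rw [← Complex.exp_add]; ring_nf
    have h3 : exp (-(Real.pi * I * s)) * exp (Real.pi * I * s) = 1 := by
      rw [← Complex.exp_add]; simp
    have hI : (2 * Real.pi * I * s) ≠ 0 := by
      simp [hpi, h0, I_ne_zero]
    have hu' : unitExp 0 (2 * Real.pi * I * s) =
        (exp (2 * Real.pi * I * s) - 1) / (2 * Real.pi * I * s) := by
      rw [eq_div_iff hI, ← hu]; ring
    rw [hu', h2, sin, show -(Real.pi * s) * I = -(Real.pi * I * s) by ring,
      show (Real.pi * s) * I = Real.pi * I * s by ring]
    rw [mul_div_assoc', div_eq_div_iff hI (mul_ne_zero hpi h0)]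
    have hII : I * I = -1 := I_mul_I
    linear_combination (Real.pi * s) * exp (Real.pi * I * s) * h3 +
      (exp (-(Real.pi * I * s)) - exp (Real.pi * I * s)) * (-(Real.pi * s)) * hII
  rw [hE, add_comm, Gamma_add_one s h0, mul_assoc s, Gamma_mul_Gamma_one_sub]
  field_simp
  rw [mul_comm s]
  exact div_self hsin

/-- The logarithmic derivative of the reflection formula, cleared of denominators so that it is
valid at `s = 0`. -/
lemma digamma_sub_digamma {s : ℂ} (hs : ‖s‖ < 1) :
    unitExp 0 (2 * Real.pi * I * s) * (digamma (1 + s) - digamma (1 - s) - Real.pi * I) +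
      2 * Real.pi * I * unitExp 1 (2 * Real.pi * I * s) = 0 := by
  have hre : |s.re| < 1 := (abs_re_le_norm s).trans_lt hs
  rw [abs_lt] at hre
  have h1 : ∀ m : ℕ, 1 + s ≠ -m := ne_neg_natCast_of_re_pos (by simp; linarith)
  have h2 : ∀ m : ℕ, 1 - s ≠ -m := ne_neg_natCast_of_re_pos (by simp; linarith)
  have d1 := (hasDerivAt_Gamma_digamma h1).comp s ((hasDerivAt_id s).const_add 1)
  have d2 := (hasDerivAt_Gamma_digamma h2).comp s ((hasDerivAt_id s).const_sub 1)
  have d3 := ((hasDerivAt_id s).const_mul (Real.pi * I : ℂ)).neg.cexp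
  have d4 := (hasDerivAt_unitExp 0 (2 * Real.pi * I * s)).comp s
    ((hasDerivAt_id s).const_mul (2 * Real.pi * I : ℂ))
  have d := (d1.mul d2).mul (d3.mul d4)
  have hc : HasDerivAt (fun _ : ℂ => (1 : ℂ)) 0 s := hasDerivAt_const s 1
  have hev : (fun z => Gamma (1 + z) * Gamma (1 - z) *
      (exp (-(Real.pi * I * z)) * unitExp 0 (2 * Real.pi * I * z))) =ᶠ[nhds s] fun _ => 1 := by
    filter_upwards [Metric.isOpen_ball.mem_nhds (mem_ball_zero_iff.2 hs)] with z hz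
    exact Gamma_mul_Gamma_mul_unitExp (mem_ball_zero_iff.1 hz)
  have hu := (hc.congr_of_eventuallyEq hev).unique d
  simp only [Function.comp, id, Pi.mul_apply, Pi.neg_apply, mul_one] at hu
  have g1 := Gamma_ne_zero h1
  have g2 := Gamma_ne_zero h2
  have g3 := exp_ne_zero (-(Real.pi * I * s))
  have key : Gamma (1 + s) * Gamma (1 - s) * exp (-(Real.pi * I * s)) *
      (unitExp 0 (2 * Real.pi * I * s) * (digamma (1 + s) - digamma (1 - s) - Real.pi * I) +
      2 * Real.pi * I * unitExp 1 (2 * Real.pi * I * s)) = 0 := by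
    rw [hu]; ring
  exact (mul_eq_zero.1 key).resolve_left (mul_ne_zero (mul_ne_zero g1 g2) g3)

/-- Differentiating `digamma_sub_digamma` at `0` gives a linear equation for `2ψ'(1)`, whose other
coefficients are the values `1/(n + 1)` of `unitExp n` at `0`. -/
theorem trigamma_one : trigamma 1 = Real.pi ^ 2 / 6 := by
  have h1 : ∀ m : ℕ, (1 : ℂ) ≠ -m := ne_neg_natCast_of_re_pos (by simp)
  have d1 := (hasDerivAt_digamma (s := 1 + 0) (by simpa using h1)).comp 0
    ((hasDerivAt_id (0 : ℂ)).const_add 1)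
  have d2 := (hasDerivAt_digamma (s := 1 - 0) (by simpa using h1)).comp 0
    ((hasDerivAt_id (0 : ℂ)).const_sub 1)
  have d4 := fun n => (hasDerivAt_unitExp n (2 * Real.pi * I * 0)).comp 0
    ((hasDerivAt_id (0 : ℂ)).const_mul (2 * Real.pi * I : ℂ))
  have d := ((d4 0).mul ((d1.sub d2).sub_const (Real.pi * I : ℂ))).add
    ((d4 1).const_mul (2 * Real.pi * I : ℂ))
  have hc : HasDerivAt (fun _ : ℂ => (0 : ℂ)) 0 0 := hasDerivAt_const 0 0
  have hev : (fun s => unitExp 0 (2 * Real.pi * I * s) *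
      (digamma (1 + s) - digamma (1 - s) - Real.pi * I) +
      2 * Real.pi * I * unitExp 1 (2 * Real.pi * I * s)) =ᶠ[nhds 0] fun _ => 0 := by
    filter_upwards [Metric.isOpen_ball.mem_nhds (Metric.mem_ball_self (x := (0 : ℂ)) one_pos)]
      with z hz
    exact digamma_sub_digamma (mem_ball_zero_iff.1 hz)
  have hu := (hc.congr_of_eventuallyEq hev).unique d
  simp only [Function.comp, Pi.sub_apply, mul_one, mul_zero, unitExp_zero_right, add_zero,
    sub_zero, zero_add] at hu
  norm_num at hu
  have hII : I * I = -1 := I_mul_I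
  linear_combination (-1 / 2 : ℂ) * hu + (-(Real.pi : ℂ) ^ 2 / 6) * hII

end Gamma

end AdaptiveSampling

/-! ### Closed form of `φ` by Gamma functions. -/

namespace AdaptiveSampling

open Complex (Gamma digamma)

/-- The substitution `t = e^(-lη)` maps the line onto `(0, ∞)` and gives Euler's integral. -/
lemma integral_exp_mul_exp_neg_exp {l c : ℝ} (hl : 0 < l) (hc : 0 < c) {s : ℂ} (hs : 0 < s.re) :
    ∫ η : ℝ, Complex.exp (-(l * η) * s) * Complex.exp (-(c * Real.exp (-l * η) : ℝ)) =
      (1 / c : ℂ) ^ s * Gamma s / l := by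
  have himg : (fun η : ℝ => Real.exp (-l * η)) '' Set.univ = Set.Ioi 0 := by
    rw [Set.image_univ]
    ext t
    simp only [Set.mem_range, Set.mem_Ioi]
    refine ⟨fun ⟨η, h⟩ => h ▸ Real.exp_pos _, fun ht => ⟨-Real.log t / l, ?_⟩⟩
    rw [show -l * (-Real.log t / l) = Real.log t by field_simp, Real.exp_log ht]
  have hderiv : ∀ η ∈ Set.univ, HasDerivWithinAt (fun η : ℝ => Real.exp (-l * η))
      (Real.exp (-l * η) * -l) Set.univ η := fun η _ => by
    have := ((hasDerivAt_id η).const_mul (-l)).exp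
    rw [mul_one] at this
    exact this.hasDerivWithinAt
  have hinj : Set.InjOn (fun η : ℝ => Real.exp (-l * η)) Set.univ := fun x _ y _ h => by
    have := Real.exp_injective h
    simpa [hl.ne'] using this
  have h := integral_image_eq_integral_abs_deriv_smul MeasurableSet.univ hderiv hinj
    (fun t : ℝ => (t : ℂ) ^ (s - 1) * Complex.exp (-(c * t)))
  rw [himg, Complex.integral_cpow_mul_exp_neg_mul_Ioi hs (by simpa using hc),
    setIntegral_univ] at h
  have hl' : (l : ℂ) ≠ 0 := by exact_mod_cast hl.ne'
  rw [h, eq_div_iff hl', mul_comm, ← integral_const_mul]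
  refine integral_congr_ae (ae_of_all _ fun η => ?_)
  have he : (Real.exp (-l * η) : ℂ) ≠ 0 := by exact_mod_cast (Real.exp_pos _).ne'
  simp only [Complex.real_smul]
  rw [abs_mul, abs_of_pos (Real.exp_pos _), abs_neg, abs_of_pos hl, Complex.cpow_def_of_ne_zero he,
    ← Complex.ofReal_log (Real.exp_pos _).le, Real.log_exp]
  have h1 : Complex.exp (-(l * η) * s) =
      (Real.exp (-l * η) : ℂ) * Complex.exp (((-l * η : ℝ) : ℂ) * (s - 1)) := by
    rw [Complex.ofReal_exp, ← Complex.exp_add]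
    congr 1; push_cast; ring
  rw [h1]
  push_cast
  ring

variable {p : ℝ}

lemma poisProb_eq (m : ℕ) {c : ℝ} (l η : ℝ) (z : ℂ) (hl : l ≠ 0) :
    Complex.exp (z * η) * (poisProb m (c * Real.exp (-l * η)) : ℂ) =
      (c ^ m / m.factorial : ℂ) * (Complex.exp (-(l * η) * (m - z / l)) *
        Complex.exp (-(c * Real.exp (-l * η) : ℝ))) := by
  have hl' : (l : ℂ) ≠ 0 := by exact_mod_cast hl
  have h1 : Complex.exp (-(l * η) * (m - z / l)) =
      Complex.exp (z * η) * (Real.exp (-l * η) : ℂ) ^ m := by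
    rw [Complex.ofReal_exp, ← Complex.exp_nat_mul, ← Complex.exp_add]
    congr 1
    push_cast
    field_simp
    ring
  rw [h1, poisProb]
  push_cast
  rw [mul_pow]
  ring

lemma integral_exp_mul_poisProb {l c : ℝ} (hl : 0 < l) (hc : 0 < c) (m : ℕ) {z : ℂ}
    (hz : 0 < (m - z / l : ℂ).re) :
    ∫ η : ℝ, Complex.exp (z * η) * (poisProb m (c * Real.exp (-l * η)) : ℂ) =
      c ^ m / m.factorial * ((1 / c : ℂ) ^ (m - z / l) * Gamma (m - z / l) / l) := by
  simp only [poisProb_eq m l _ z hl.ne']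
  rw [integral_const_mul, integral_exp_mul_exp_neg_exp hl hc hz]

/-- The integral of a nonintegrable function is `0` by convention, whereas the value just computed
is nonzero because `Γ` has no zero in the right half-plane. -/
lemma integrable_exp_mul_poisProb {l c : ℝ} (hl : 0 < l) (hc : 0 < c) (m : ℕ) {z : ℂ}
    (hz : 0 < (m - z / l : ℂ).re) :
    Integrable fun η : ℝ => Complex.exp (z * η) * (poisProb m (c * Real.exp (-l * η)) : ℂ) := by
  by_contra h
  have h0 := integral_undef h
  rw [integral_exp_mul_poisProb hl hc m hz] at h0
  have hc' : (c : ℂ) ≠ 0 := by exact_mod_cast hc.ne'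
  have hl' : (l : ℂ) ≠ 0 := by exact_mod_cast hl.ne'
  have hm : (m.factorial : ℂ) ≠ 0 := by exact_mod_cast m.factorial_ne_zero
  have hcp : (1 / c : ℂ) ^ (m - z / l) ≠ 0 := by
    rw [Complex.cpow_def_of_ne_zero (one_div_ne_zero hc')]
    exact Complex.exp_ne_zero _
  have := Complex.Gamma_ne_zero_of_re_pos hz
  exact (mul_ne_zero (div_ne_zero (pow_ne_zero m hc') hm)
    (div_ne_zero (mul_ne_zero hcp this) hl')) h0

/-- The closed form of `φ` where all the Gamma integrals converge. -/
lemma phi_eq_Gamma_of_re (hp0 : 0 < p) (hp1 : p < 1) (b k : ℕ) {z : ℂ}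
    (hz : 0 < (k - z / L p : ℂ).re) :
    φ p b k z = (Gamma (k - z / L p) / k.factorial -
      Complex.exp z * ∑ i ∈ Finset.range (b - k + 1),
        ((1 - p) ^ k * p ^ i / (k.factorial * i.factorial) : ℂ) *
          Gamma (k + i - z / L p)) / L p := by
  have hL := L_pos hp0 hp1
  have hq : 0 < 1 - p := by linarith
  have hzi : ∀ i : ℕ, 0 < (((k + i : ℕ) : ℂ) - z / L p : ℂ).re := by
    intro i
    simp only [Complex.sub_re, Complex.natCast_re] at hz ⊢
    push_cast
    have : (0 : ℝ) ≤ i := Nat.cast_nonneg i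
    linarith
  have hsplit : ∀ η : ℝ, Complex.exp (z * η) * (f p b k η : ℂ) =
      Complex.exp (z * η) * (poisProb k (1 * Real.exp (-L p * η)) : ℂ) -
      ∑ i ∈ Finset.range (b - k + 1), ((k + i).choose k * (1 - p) ^ k * p ^ i : ℂ) *
        (Complex.exp (z * η) * (poisProb (k + i) (1 / (1 - p) * Real.exp (-L p * η)) : ℂ)) := by
    intro η
    rw [f_eq hp1, one_mul, one_div_mul_eq_div]
    push_cast
    rw [mul_sub, Finset.mul_sum]
    congr 1
    refine Finset.sum_congr rfl fun i _ => ?_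
    ring
  have hint1 := integrable_exp_mul_poisProb hL one_pos k hz
  have hint2 := fun i => integrable_exp_mul_poisProb hL (one_div_pos.2 hq) (k + i) (hzi i)
  rw [φ]
  simp only [hsplit]
  rw [integral_sub hint1 (integrable_finsetSum _ fun i _ => (hint2 i).const_mul _),
    integral_finsetSum _ fun i _ => (hint2 i).const_mul _]
  simp only [integral_const_mul]
  rw [integral_exp_mul_poisProb hL one_pos k hz, sub_div, Finset.mul_sum,
    Finset.sum_div]
  congr 1
  · simp
    ring
  refine Finset.sum_congr rfl fun i _ => ?_
  rw [integral_exp_mul_poisProb hL (one_div_pos.2 hq) (k + i) (hzi i)]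
  have hq' : ((1 - p : ℝ) : ℂ) ≠ 0 := by exact_mod_cast hq.ne'
  have hL' : (L p : ℂ) ≠ 0 := by exact_mod_cast hL.ne'
  have hlog : Complex.log ((1 - p : ℝ) : ℂ) = -(L p : ℂ) := by
    rw [← Complex.ofReal_log hq.le, ← exp_neg_L hp1, Real.log_exp]
    push_cast; rfl
  -- Since `log q = -L`, the power `q^(-z/L)` is `e^z`.
  have hpow : (1 / ((1 / (1 - p) : ℝ) : ℂ)) ^ (((k + i : ℕ) : ℂ) - z / L p) =
      ((1 - p : ℝ) : ℂ) ^ (k + i) * Complex.exp z := by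
    have : 1 / ((1 / (1 - p) : ℝ) : ℂ) = ((1 - p : ℝ) : ℂ) := by push_cast; simp
    rw [this, Complex.cpow_sub _ _ hq', Complex.cpow_natCast, Complex.cpow_def_of_ne_zero hq', hlog,
      div_eq_mul_inv, ← Complex.exp_neg]
    congr 2
    field_simp
  have hch : ((k + i).choose k : ℂ) = (k + i).factorial / (k.factorial * i.factorial) := by
    rw [Nat.cast_choose ℂ (Nat.le_add_right k i), Nat.add_sub_cancel_left]
  have hf1 : ((k + i).factorial : ℂ) ≠ 0 := by exact_mod_cast (k + i).factorial_ne_zero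
  rw [hpow, hch]
  push_cast at hq' ⊢
  rw [div_pow, one_pow]
  field_simp

lemma convex_strip (a : ℝ) : Convex ℝ {z : ℂ | |z.re| < a} := by
  have : {z : ℂ | |z.re| < a} = Complex.reLm ⁻¹' Set.Ioo (-a) a := by
    ext z; simp [abs_lt]
  rw [this]
  exact (convex_Ioo _ _).linear_preimage Complex.reLm

lemma isOpen_strip (a : ℝ) : IsOpen {z : ℂ | |z.re| < a} :=
  isOpen_lt (by fun_prop) continuous_const

lemma re_natCast_sub_div_pos (hp0 : 0 < p) (hp1 : p < 1) {k : ℕ} (hk : k ≠ 0) {z : ℂ}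
    (hz : |z.re| < L p) : 0 < ((k : ℂ) - z / L p : ℂ).re := by
  have hL := L_pos hp0 hp1
  rw [Complex.sub_re, Complex.natCast_re, Complex.div_ofReal_re, sub_pos, div_lt_iff₀ hL]
  have : (1 : ℝ) ≤ k := by exact_mod_cast Nat.one_le_iff_ne_zero.2 hk
  nlinarith [(abs_lt.1 hz).2]

/-- The leading term and the summand `i = 0` combine to `Γ(-z/L)(1 - e^z)/L`, which equals `Γ(1 -
z/L)(e^z - 1)/z` and is regular at `0`. -/
lemma closedForm_zero_eq (hp0 : 0 < p) (hp1 : p < 1) (b : ℕ) {z : ℂ} (hz0 : z ≠ 0) :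
    (Gamma ((0 : ℕ) - z / L p) / (Nat.factorial 0) -
      Complex.exp z * ∑ i ∈ Finset.range (b - 0 + 1),
        ((1 - p) ^ 0 * p ^ i / ((Nat.factorial 0) * i.factorial) : ℂ) *
          Gamma ((0 : ℕ) + i - z / L p)) / L p = Gamma (1 - z / L p) * unitExp 0 z -
      Complex.exp z * ∑ i ∈ Finset.range b, (p ^ (i + 1) / (i + 1).factorial : ℂ) *
          Gamma ((i + 1 : ℕ) - z / L p) / L p := by
  have hL' : (L p : ℂ) ≠ 0 := by exact_mod_cast (L_pos hp0 hp1).ne'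
  rw [Finset.sum_range_succ']
  have hu := mul_unitExp_zero z
  have hg : Gamma (1 - z / L p) = -(z / L p) * Gamma (-(z / L p)) := by
    rw [← Complex.Gamma_add_one _ (neg_ne_zero.2 (div_ne_zero hz0 hL'))]
    ring_nf
  rw [hg]
  simp only [Nat.sub_zero, Nat.cast_zero, zero_sub, zero_add, Nat.factorial_zero, Nat.cast_one,
    pow_zero, one_mul, add_zero, div_one, mul_one]
  rw [mul_add, ← sub_sub, Finset.mul_sum, Finset.mul_sum, sub_div, sub_div, Finset.sum_div]
  have hsum : ∑ i ∈ Finset.range b, Complex.exp z * (((p : ℂ) ^ (i + 1) / (i + 1).factorial) *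
        Gamma (((i + 1 : ℕ) : ℂ) - z / L p)) / L p =
      ∑ i ∈ Finset.range b, Complex.exp z * (((p : ℂ) ^ (i + 1) / (i + 1).factorial) *
        Gamma (((i + 1 : ℕ) : ℂ) - z / L p) / L p) :=
    Finset.sum_congr rfl fun i _ => by ring
  rw [hsum]
  linear_combination (Gamma (-(z / L p)) / L p) * hu

/-- The holomorphic expression of `φ(0, ·)` in a strip around the imaginary axis. -/
lemma phi_zero_eq (hp0 : 0 < p) (hp1 : p < 1) (b : ℕ) {z : ℂ} (hz : |z.re| < L p) :
    φ p b 0 z = Gamma (1 - z / L p) * unitExp 0 z -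
      Complex.exp z * ∑ i ∈ Finset.range b, (p ^ (i + 1) / (i + 1).factorial : ℂ) *
          Gamma ((i + 1 : ℕ) - z / L p) / L p := by
  have hL := L_pos hp0 hp1
  have hL' : (L p : ℂ) ≠ 0 := by exact_mod_cast hL.ne'
  set U : Set ℂ := {z : ℂ | |z.re| < L p} with hU
  have hUo : IsOpen U := isOpen_strip _
  have hG : ∀ m : ℕ, m ≠ 0 → ∀ w ∈ U, DifferentiableAt ℂ (fun z => Gamma (m - z / L p)) w := by
    intro m hm w hw
    have h1 := Complex.differentiableAt_Gamma _
      (ne_neg_natCast_of_re_pos (re_natCast_sub_div_pos hp0 hp1 hm hw))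
    exact h1.comp w (by fun_prop)
  have ha1 : AnalyticOnNhd ℂ (φ p b 0) U := fun w hw => analyticAt_phi hp0 hp1 b 0 hw
  have ha2 : AnalyticOnNhd ℂ (fun z => Gamma (1 - z / L p) * unitExp 0 z -
      Complex.exp z * ∑ i ∈ Finset.range b, (p ^ (i + 1) / (i + 1).factorial : ℂ) *
          Gamma ((i + 1 : ℕ) - z / L p) / L p) U := by
    refine DifferentiableOn.analyticOnNhd (fun w hw => ?_) hUo
    have h1 := hG 1 one_ne_zero w hw
    rw [Nat.cast_one] at h1
    refine DifferentiableAt.differentiableWithinAt ?_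
    refine (h1.mul (hasDerivAt_unitExp 0 w).differentiableAt).sub
      (Complex.differentiable_exp.differentiableAt.mul ?_)
    refine DifferentiableAt.fun_sum fun i _ => ?_
    exact ((hG (i + 1) i.succ_ne_zero w hw).const_mul _).div_const _
  -- For `k = 0` the Gamma integrals converge separately only when `Re z < 0`. The formula holds
  -- near this point of the strip, and the identity theorem extends it.
  have hz0 : -(L p / 2 : ℂ) ∈ U := by
    rw [hU, Set.mem_ofPred_eq]
    have : (-(L p / 2 : ℂ)).re = -(L p / 2) := by
      rw [Complex.neg_re, show (L p / 2 : ℂ) = ((L p / 2 : ℝ) : ℂ) by push_cast; rfl,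
        Complex.ofReal_re]
    rw [this, abs_neg, abs_of_pos (by positivity)]
    linarith
  refine ha1.eqOn_of_preconnected_of_eventuallyEq ha2 (convex_strip _).isPreconnected hz0 ?_ hz
  have hneg : ∀ᶠ w : ℂ in nhds (-(L p / 2 : ℂ)), w.re < 0 := by
    refine (isOpen_lt Complex.continuous_re continuous_const).mem_nhds ?_
    rw [Set.mem_ofPred_eq, show (-(L p / 2) : ℂ) = ((-(L p / 2) : ℝ) : ℂ) by push_cast; rfl,
        Complex.ofReal_re]
    linarith
  filter_upwards [hneg] with w hw
  have hw0 : w ≠ 0 := by rintro rfl; simp at hw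
  rw [phi_eq_Gamma_of_re hp0 hp1]
  · exact closedForm_zero_eq hp0 hp1 b hw0
  · rw [Complex.sub_re, Complex.natCast_re, Complex.div_ofReal_re, Nat.cast_zero, zero_sub,
      neg_pos]
    exact div_neg_of_neg_of_pos hw hL

/-- The closed form of `φ` in a strip around the imaginary axis. -/
lemma phi_eq_Gamma (hp0 : 0 < p) (hp1 : p < 1) (b k : ℕ) {z : ℂ}
    (hz : |z.re| < L p) (hkz : k ≠ 0 ∨ z ≠ 0) :
    φ p b k z = (Gamma (k - z / L p) / k.factorial -
      Complex.exp z * ∑ i ∈ Finset.range (b - k + 1),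
        ((1 - p) ^ k * p ^ i / (k.factorial * i.factorial) : ℂ) *
          Gamma (k + i - z / L p)) / L p := by
  rcases eq_or_ne k 0 with rfl | hk
  · rw [phi_zero_eq hp0 hp1 b hz, closedForm_zero_eq hp0 hp1 b (by simpa using hkz)]
  · exact phi_eq_Gamma_of_re hp0 hp1 b k (re_natCast_sub_div_pos hp0 hp1 hk hz)

end AdaptiveSampling

/-! ### Derivatives of `φ` and the explicit moment formulas. -/

namespace AdaptiveSampling

open Complex (Gamma digamma)

variable {p : ℝ}

lemma hasDerivAt_Gamma_sub_div (a l : ℂ) {z : ℂ} (hs : ∀ m : ℕ, a - z / l ≠ -m) :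
    HasDerivAt (fun z => Gamma (a - z / l))
      (-(digamma (a - z / l) * Gamma (a - z / l)) / l) z := by
  have h := (hasDerivAt_Gamma_digamma hs).comp z (((hasDerivAt_id z).div_const l).const_sub a)
  refine h.congr_deriv ?_
  ring

lemma hasDerivAt_digamma_mul_Gamma_sub_div (a l : ℂ) {z : ℂ} (hs : ∀ m : ℕ, a - z / l ≠ -m) :
    HasDerivAt (fun z => -(digamma (a - z / l) * Gamma (a - z / l)) / l)
      ((trigamma (a - z / l) + digamma (a - z / l) ^ 2) * Gamma (a - z / l) / l ^ 2) z := by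
  have h1 := (hasDerivAt_digamma hs).comp z (((hasDerivAt_id z).div_const l).const_sub a)
  have h := ((h1.mul (hasDerivAt_Gamma_sub_div a l hs)).neg).div_const l
  refine h.congr_deriv ?_
  simp only [Function.comp, id]
  ring

/-- The poles in question lie at `z = (k + i + m) L`, and the strip contains such a point only if it
is `0`, which needs `k = 0` and `z = 0`. -/
lemma natCast_sub_div_ne (hp0 : 0 < p) (hp1 : p < 1) {k : ℕ} {z : ℂ} (hz : |z.re| < L p)
    (hkz : k ≠ 0 ∨ z ≠ 0) (i m : ℕ) : ((k : ℂ) + i - z / L p) ≠ -m := by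
  intro h
  have hL := L_pos hp0 hp1
  have hL' : (L p : ℂ) ≠ 0 := by exact_mod_cast hL.ne'
  have hzeq : z = (((k + i + m : ℕ) : ℝ) * L p : ℝ) := by
    push_cast
    field_simp at h
    linear_combination -h
  rw [hzeq, Complex.ofReal_re, abs_mul, abs_of_pos hL, Nat.abs_cast] at hz
  have hlt : ((k + i + m : ℕ) : ℝ) < 1 := by
    by_contra hge
    nlinarith [not_lt.1 hge]
  have h0 : k + i + m = 0 := by
    have : k + i + m < 1 := by exact_mod_cast hlt
    omega
  rcases hkz with hk | hz0
  · omega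
  · rw [h0] at hzeq
    exact hz0 (by simpa using hzeq)

/-- The derivative of `φ`. -/
noncomputable def phiDeriv (p : ℝ) (b k : ℕ) (z : ℂ) : ℂ :=
  (-(digamma (k - z / L p) * Gamma (k - z / L p)) / L p / k.factorial -
    Complex.exp z * ∑ i ∈ Finset.range (b - k + 1),
      ((1 - p) ^ k * p ^ i / (k.factorial * i.factorial) : ℂ) *
        (Gamma (k + i - z / L p) +
          -(digamma (k + i - z / L p) * Gamma (k + i - z / L p)) / L p)) / L p

lemma hasDerivAt_phi (hp0 : 0 < p) (hp1 : p < 1) (b k : ℕ) {z : ℂ} (hz : |z.re| < L p)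
    (hkz : k ≠ 0 ∨ z ≠ 0) : HasDerivAt (φ p b k) (phiDeriv p b k z) z := by
  have hne := natCast_sub_div_ne hp0 hp1 hz hkz
  have hne0 : ∀ m : ℕ, (k : ℂ) - z / L p ≠ -m := fun m => by simpa using hne 0 m
  have hev : φ p b k =ᶠ[nhds z] fun z => (Gamma (k - z / L p) / k.factorial -
      Complex.exp z * ∑ i ∈ Finset.range (b - k + 1),
        ((1 - p) ^ k * p ^ i / (k.factorial * i.factorial) : ℂ) *
          Gamma (k + i - z / L p)) / L p := by
    have h2 : ∀ᶠ w in nhds z, k ≠ 0 ∨ w ≠ 0 := by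
      rcases hkz with hk | hz0
      · exact Eventually.of_forall fun _ => Or.inl hk
      · filter_upwards [isOpen_ne.mem_nhds hz0] with w hw using Or.inr hw
    filter_upwards [(isOpen_strip (L p)).mem_nhds hz, h2] with w hw hkw
    exact phi_eq_Gamma hp0 hp1 b k hw hkw
  refine HasDerivAt.congr_of_eventuallyEq ?_ hev
  have h := (((hasDerivAt_Gamma_sub_div k (L p) hne0).div_const (k.factorial : ℂ)).sub
    ((Complex.hasDerivAt_exp z).mul (HasDerivAt.fun_sum (u := Finset.range (b - k + 1)) fun i _ =>
      (hasDerivAt_Gamma_sub_div (k + i) (L p) (hne i)).const_mul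
        ((1 - p) ^ k * p ^ i / (k.factorial * i.factorial) : ℂ)))).div_const (L p : ℂ)
  refine h.congr_deriv ?_
  rw [phiDeriv]
  simp only [mul_add, Finset.sum_add_distrib]

lemma hasDerivAt_phiDeriv (hp0 : 0 < p) (hp1 : p < 1) (b k : ℕ) {z : ℂ} (hz : |z.re| < L p)
    (hkz : k ≠ 0 ∨ z ≠ 0) : HasDerivAt (phiDeriv p b k)
      (((trigamma (k - z / L p) + digamma (k - z / L p) ^ 2) * Gamma (k - z / L p) / L p ^ 2 /
          k.factorial -
        Complex.exp z * ∑ i ∈ Finset.range (b - k + 1),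
          ((1 - p) ^ k * p ^ i / (k.factorial * i.factorial) : ℂ) *
            (Gamma (k + i - z / L p) +
              2 * (-(digamma (k + i - z / L p) * Gamma (k + i - z / L p)) / L p) +
              (trigamma (k + i - z / L p) + digamma (k + i - z / L p) ^ 2) *
                Gamma (k + i - z / L p) / L p ^ 2)) / L p) z := by
  have hne := natCast_sub_div_ne hp0 hp1 hz hkz
  have hne0 : ∀ m : ℕ, (k : ℂ) - z / L p ≠ -m := fun m => by simpa using hne 0 m
  have h := (((hasDerivAt_digamma_mul_Gamma_sub_div k (L p) hne0).div_const (k.factorial : ℂ)).sub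
    ((Complex.hasDerivAt_exp z).mul (HasDerivAt.fun_sum (u := Finset.range (b - k + 1)) fun i _ =>
      ((hasDerivAt_Gamma_sub_div (k + i) (L p) (hne i)).add
        (hasDerivAt_digamma_mul_Gamma_sub_div (k + i) (L p) (hne i))).const_mul
        ((1 - p) ^ k * p ^ i / (k.factorial * i.factorial) : ℂ)))).div_const (L p : ℂ)
  refine h.congr_deriv ?_
  rw [← mul_add, ← Finset.sum_add_distrib]
  congr 3
  refine Finset.sum_congr rfl fun i _ => ?_
  simp only [Pi.add_apply]
  ring

lemma zero_mem_strip (hp0 : 0 < p) (hp1 : p < 1) : |(0 : ℂ).re| < L p := by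
  simpa using L_pos hp0 hp1

lemma Gamma_div_factorial {k : ℕ} (hk : k ≠ 0) :
    Gamma (k : ℂ) / k.factorial = 1 / k := by
  have hk' : (k : ℂ) ≠ 0 := by exact_mod_cast hk
  have h1 := Complex.Gamma_add_one (k : ℂ) hk'
  have h2 : (k.factorial : ℂ) ≠ 0 := by exact_mod_cast k.factorial_ne_zero
  rw [Complex.Gamma_nat_eq_factorial] at h1
  rw [div_eq_div_iff h2 hk', h1]
  ring

/-- The nonperiodic part of the first moment for positive sizes. -/
theorem mTilde_one (hp0 : 0 < p) (hp1 : p < 1) (b : ℕ) {k : ℕ} (hk : k ≠ 0) :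
    mTilde p b 1 k = -(digamma k) / ((L p : ℂ) ^ 2 * k) +
        ∑ i ∈ Finset.range (b - k + 1),
          (digamma ((k : ℂ) + i) - L p) * ((1 - p : ℝ) : ℂ) ^ k * (p : ℂ) ^ i *
              Gamma ((k : ℂ) + i) /
            ((L p : ℂ) ^ 2 * Gamma ((k : ℂ) + 1) * Gamma ((i : ℂ) + 1)) := by
  have hL' : (L p : ℂ) ≠ 0 := by exact_mod_cast (L_pos hp0 hp1).ne'
  rw [mTilde, iteratedDeriv_one,
    (hasDerivAt_phi hp0 hp1 b k (zero_mem_strip hp0 hp1) (Or.inl hk)).deriv, phiDeriv]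
  simp only [zero_div, sub_zero, Complex.exp_zero, one_mul, Complex.Gamma_nat_eq_factorial]
  rw [sub_div, Finset.sum_div, sub_eq_add_neg, ← Finset.sum_neg_distrib]
  congr 1
  · have := Gamma_div_factorial hk
    calc _ = -(digamma k) / (L p : ℂ) ^ 2 * (Gamma (k : ℂ) / k.factorial) := by ring
      _ = _ := by rw [this]; ring
  · refine Finset.sum_congr rfl fun i _ => ?_
    push_cast
    field_simp
    ring

/-- The nonperiodic part of the second moment for positive sizes. -/
theorem mTilde_two (hp0 : 0 < p) (hp1 : p < 1) (b : ℕ) {k : ℕ} (hk : k ≠ 0) :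
    mTilde p b 2 k = (trigamma k + digamma k ^ 2) / ((L p : ℂ) ^ 3 * k) +
        ∑ i ∈ Finset.range (b - k + 1),
          -((-2 * digamma ((k : ℂ) + i) * L p + (L p : ℂ) ^ 2 +
                trigamma ((k : ℂ) + i) + digamma ((k : ℂ) + i) ^ 2) *
              ((1 - p : ℝ) : ℂ) ^ k * (p : ℂ) ^ i * Gamma ((k : ℂ) + i) /
            ((L p : ℂ) ^ 3 * Gamma ((k : ℂ) + 1) * Gamma ((i : ℂ) + 1))) := by
  have hL' : (L p : ℂ) ≠ 0 := by exact_mod_cast (L_pos hp0 hp1).ne'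
  have hev : deriv (φ p b k) =ᶠ[nhds 0] phiDeriv p b k := by
    filter_upwards [(isOpen_strip (L p)).mem_nhds (zero_mem_strip hp0 hp1)] with w hw
    exact (hasDerivAt_phi hp0 hp1 b k hw (Or.inl hk)).deriv
  rw [mTilde, iteratedDeriv_succ, iteratedDeriv_one, hev.deriv_eq,
    (hasDerivAt_phiDeriv hp0 hp1 b k (zero_mem_strip hp0 hp1) (Or.inl hk)).deriv]
  simp only [zero_div, sub_zero, Complex.exp_zero, one_mul, Complex.Gamma_nat_eq_factorial]
  rw [sub_div, Finset.sum_div, sub_eq_add_neg, ← Finset.sum_neg_distrib]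
  congr 1
  · have := Gamma_div_factorial hk
    calc _ = (trigamma k + digamma k ^ 2) / (L p : ℂ) ^ 3 * (Gamma (k : ℂ) / k.factorial) := by
          ring
      _ = _ := by rw [this]; ring
  · refine Finset.sum_congr rfl fun i _ => ?_
    push_cast
    field_simp
    ring

/-- The derivative of `φ(0, ·)` near `0`. -/
noncomputable def phiZeroDeriv (p : ℝ) (b : ℕ) (z : ℂ) : ℂ :=
  (-(digamma (1 - z / L p) * Gamma (1 - z / L p)) / L p) * unitExp 0 z +
      Gamma (1 - z / L p) * unitExp 1 z -
    Complex.exp z * ∑ i ∈ Finset.range b, (p ^ (i + 1) / (i + 1).factorial : ℂ) *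
      (Gamma ((i + 1 : ℕ) - z / L p) +
        -(digamma ((i + 1 : ℕ) - z / L p) * Gamma ((i + 1 : ℕ) - z / L p)) / L p) / L p

lemma succ_sub_div_ne (hp0 : 0 < p) (hp1 : p < 1) {z : ℂ} (hz : |z.re| < L p) (i m : ℕ) :
    ((i + 1 : ℕ) : ℂ) - z / L p ≠ -m :=
  ne_neg_natCast_of_re_pos (re_natCast_sub_div_pos hp0 hp1 i.succ_ne_zero hz) m

lemma one_sub_div_ne (hp0 : 0 < p) (hp1 : p < 1) {z : ℂ} (hz : |z.re| < L p) (m : ℕ) :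
    1 - z / L p ≠ -m := by
  simpa using succ_sub_div_ne hp0 hp1 hz 0 m

lemma hasDerivAt_phi_zero (hp0 : 0 < p) (hp1 : p < 1) (b : ℕ) {z : ℂ} (hz : |z.re| < L p) :
    HasDerivAt (φ p b 0) (phiZeroDeriv p b z) z := by
  have hev : φ p b 0 =ᶠ[nhds z] fun z => Gamma (1 - z / L p) * unitExp 0 z -
      Complex.exp z * ∑ i ∈ Finset.range b, (p ^ (i + 1) / (i + 1).factorial : ℂ) *
          Gamma ((i + 1 : ℕ) - z / L p) / L p := by
    filter_upwards [(isOpen_strip (L p)).mem_nhds hz] with w hw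
    exact phi_zero_eq hp0 hp1 b hw
  refine HasDerivAt.congr_of_eventuallyEq ?_ hev
  have h := ((hasDerivAt_Gamma_sub_div 1 (L p) (one_sub_div_ne hp0 hp1 hz)).mul
    (hasDerivAt_unitExp 0 z)).sub
    ((Complex.hasDerivAt_exp z).mul (HasDerivAt.fun_sum (u := Finset.range b) fun i _ =>
      ((hasDerivAt_Gamma_sub_div (i + 1 : ℕ) (L p) (succ_sub_div_ne hp0 hp1 hz i)).const_mul
        (p ^ (i + 1) / (i + 1).factorial : ℂ)).div_const (L p : ℂ)))
  refine h.congr_deriv ?_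
  rw [phiZeroDeriv]
  simp only [mul_add, add_div, Finset.sum_add_distrib]

lemma hasDerivAt_phiZeroDeriv (hp0 : 0 < p) (hp1 : p < 1) (b : ℕ) {z : ℂ} (hz : |z.re| < L p) :
    HasDerivAt (phiZeroDeriv p b)
      (((trigamma (1 - z / L p) + digamma (1 - z / L p) ^ 2) * Gamma (1 - z / L p) / L p ^ 2) *
          unitExp 0 z +
        2 * ((-(digamma (1 - z / L p) * Gamma (1 - z / L p)) / L p) * unitExp 1 z) +
        Gamma (1 - z / L p) * unitExp 2 z -
      Complex.exp z * ∑ i ∈ Finset.range b, (p ^ (i + 1) / (i + 1).factorial : ℂ) *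
        (Gamma ((i + 1 : ℕ) - z / L p) +
          2 * (-(digamma ((i + 1 : ℕ) - z / L p) * Gamma ((i + 1 : ℕ) - z / L p)) / L p) +
          (trigamma ((i + 1 : ℕ) - z / L p) + digamma ((i + 1 : ℕ) - z / L p) ^ 2) *
            Gamma ((i + 1 : ℕ) - z / L p) / L p ^ 2) / L p) z := by
  have hne := succ_sub_div_ne hp0 hp1 hz
  have hne1 := one_sub_div_ne hp0 hp1 hz
  have h := (((hasDerivAt_digamma_mul_Gamma_sub_div 1 (L p) hne1).mul
      (hasDerivAt_unitExp 0 z)).add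
    ((hasDerivAt_Gamma_sub_div 1 (L p) hne1).mul (hasDerivAt_unitExp 1 z))).sub
    ((Complex.hasDerivAt_exp z).mul (HasDerivAt.fun_sum (u := Finset.range b) fun i _ =>
      (((hasDerivAt_Gamma_sub_div (i + 1 : ℕ) (L p) (hne i)).add
        (hasDerivAt_digamma_mul_Gamma_sub_div (i + 1 : ℕ) (L p) (hne i))).const_mul
        (p ^ (i + 1) / (i + 1).factorial : ℂ)).div_const (L p : ℂ)))
  refine h.congr_deriv ?_
  rw [← mul_add, ← Finset.sum_add_distrib]
  congr 1
  · ring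
  · congr 1
    refine Finset.sum_congr rfl fun i _ => ?_
    simp only [Pi.add_apply]
    ring

lemma sum_Icc_one (b : ℕ) (g : ℕ → ℂ) :
    ∑ i ∈ Finset.Icc 1 b, g i = ∑ i ∈ Finset.range b, g (i + 1) := by
  rw [← Finset.Ico_add_one_right_eq_Icc, Finset.sum_Ico_eq_sum_range]
  refine Finset.sum_congr rfl fun i _ => ?_
  rw [add_comm]

/-- The nonperiodic part of the first moment for size `0`. -/
theorem mTilde_one_zero (hp0 : 0 < p) (hp1 : p < 1) (b : ℕ) :
    mTilde p b 1 0 = 1 / 2 + (Real.eulerMascheroniConstant : ℂ) / L p +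
      ∑ i ∈ Finset.Icc 1 b,
        (digamma (i : ℂ) - L p) * (p : ℂ) ^ i / ((i : ℂ) * (L p : ℂ) ^ 2) := by
  have hL' : (L p : ℂ) ≠ 0 := by exact_mod_cast (L_pos hp0 hp1).ne'
  rw [mTilde, iteratedDeriv_one,
    (hasDerivAt_phi_zero hp0 hp1 b (zero_mem_strip hp0 hp1)).deriv, phiZeroDeriv, sum_Icc_one]
  -- The constant `1/2` is `unitExp 1 0`, and `γ/L` comes from `ψ(1) = -γ`.
  simp only [zero_div, sub_zero, Complex.exp_zero, one_mul, unitExp_zero_right,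
    Complex.digamma_one, Complex.Gamma_one]
  rw [sub_eq_add_neg, ← Finset.sum_neg_distrib]
  congr 1
  · push_cast; ring
  · refine Finset.sum_congr rfl fun i _ => ?_
    have := Gamma_div_factorial i.succ_ne_zero
    rw [Nat.succ_eq_add_one] at this
    calc _ = (Gamma ((i + 1 : ℕ) : ℂ) / (i + 1).factorial) * (p : ℂ) ^ (i + 1) *
          (digamma ((i + 1 : ℕ) : ℂ) - L p) / (L p : ℂ) ^ 2 := by field_simp; ring
      _ = _ := by rw [this]; ring

/-- The nonperiodic part of the second moment for size `0`. -/
theorem mTilde_two_zero (hp0 : 0 < p) (hp1 : p < 1) (b : ℕ) :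
    mTilde p b 2 0 =
      1 / 3 + (Real.eulerMascheroniConstant : ℂ) / L p + (Real.pi : ℂ) ^ 2 / (6 * (L p : ℂ) ^ 2) +
        (Real.eulerMascheroniConstant : ℂ) ^ 2 / (L p : ℂ) ^ 2 +
      ∑ i ∈ Finset.Icc 1 b,
        -((-2 * digamma (i : ℂ) * L p + (L p : ℂ) ^ 2 +
              trigamma (i : ℂ) + digamma (i : ℂ) ^ 2) * (p : ℂ) ^ i /
          ((i : ℂ) * (L p : ℂ) ^ 3)) := by
  have hL' : (L p : ℂ) ≠ 0 := by exact_mod_cast (L_pos hp0 hp1).ne'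
  have hev : deriv (φ p b 0) =ᶠ[nhds 0] phiZeroDeriv p b := by
    filter_upwards [(isOpen_strip (L p)).mem_nhds (zero_mem_strip hp0 hp1)] with w hw
    exact (hasDerivAt_phi_zero hp0 hp1 b hw).deriv
  rw [mTilde, iteratedDeriv_succ, iteratedDeriv_one, hev.deriv_eq,
    (hasDerivAt_phiZeroDeriv hp0 hp1 b (zero_mem_strip hp0 hp1)).deriv, sum_Icc_one]
  -- The constant `1/3` is `unitExp 2 0`, `γ/L` is the cross term of the product rule, and `ψ'(1) +
  -- ψ(1)²` gives `π²/6 + γ²`.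
  simp only [zero_div, sub_zero, Complex.exp_zero, one_mul, unitExp_zero_right,
    Complex.digamma_one, Complex.Gamma_one, trigamma_one]
  rw [sub_eq_add_neg, ← Finset.sum_neg_distrib]
  congr 1
  · push_cast; field_simp; ring
  · refine Finset.sum_congr rfl fun i _ => ?_
    have := Gamma_div_factorial i.succ_ne_zero
    rw [Nat.succ_eq_add_one] at this
    calc _ = -((Gamma ((i + 1 : ℕ) : ℂ) / (i + 1).factorial) * (p : ℂ) ^ (i + 1) *
          (-2 * digamma ((i + 1 : ℕ) : ℂ) * L p + (L p : ℂ) ^ 2 + trigamma ((i + 1 : ℕ) : ℂ) +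
            digamma ((i + 1 : ℕ) : ℂ) ^ 2) / (L p : ℂ) ^ 3) := by field_simp; ring
      _ = _ := by rw [this]; ring

/-- The terms of the Fourier series of the periodic part of the first moment. -/
theorem wTerm_one (hp0 : 0 < p) (hp1 : p < 1) (b k : ℕ) (x : ℝ) {l : ℤ} (hl : l ≠ 0) :
    wTerm p b 1 k x l =
      (-(digamma ((k : ℂ) + χ p l) * Gamma ((k : ℂ) + χ p l)) /
          ((L p : ℂ) ^ 2 * Gamma ((k : ℂ) + 1)) +
        ∑ i ∈ Finset.range (b - k + 1),
          (digamma ((k : ℂ) + i + χ p l) - L p) * Gamma ((k : ℂ) + i + χ p l) *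
              ((1 - p : ℝ) : ℂ) ^ k * (p : ℂ) ^ i /
            ((L p : ℂ) ^ 2 * Gamma ((k : ℂ) + 1) * Gamma ((i : ℂ) + 1))) *
        Complex.exp (-(2 * (l : ℂ) * (Real.pi : ℂ) * Complex.I * (x : ℂ))) := by
  have hL := L_pos hp0 hp1
  have hL' : (L p : ℂ) ≠ 0 := by exact_mod_cast hL.ne'
  have hz := neg_L_mul_chi hp0 hp1 l
  have hstrip : |(-(L p : ℂ) * χ p l).re| < L p := by
    rw [hz]
    have : (-(2 * (Real.pi : ℂ) * l * Complex.I)).re = 0 := by simp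
    rw [this, abs_zero]
    exact hL
  have hz0 : -(L p : ℂ) * χ p l ≠ 0 := by
    rw [hz]
    simp [hl, Real.pi_ne_zero, Complex.I_ne_zero]
  -- The factor `e^z` of the closed form disappears because `-L χ_l` is a multiple of `2πi`.
  have hexp : Complex.exp (-(L p : ℂ) * χ p l) = 1 := by
    rw [hz, Complex.exp_eq_one_iff]
    exact ⟨-l, by push_cast; ring⟩
  have hsub : ∀ a : ℂ, a - -(L p : ℂ) * χ p l / L p = a + χ p l := by
    intro a
    field_simp
    ring
  rw [wTerm, iteratedDeriv_one, (hasDerivAt_phi hp0 hp1 b k hstrip (Or.inr hz0)).deriv, phiDeriv,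
    hexp]
  simp only [hsub, one_mul, Complex.Gamma_nat_eq_factorial]
  congr 1
  rw [sub_div, Finset.sum_div, sub_eq_add_neg, ← Finset.sum_neg_distrib]
  congr 1
  · ring
  · refine Finset.sum_congr rfl fun i _ => ?_
    push_cast
    field_simp
    ring

end AdaptiveSampling

/-! ### Assembly of the theorem. -/

theorem mainTheorem9
    (p : ℝ) (hp0 : 0 < p) (hp1 : p < 1) (b : ℕ)
    {Ω : Type*} [MeasurableSpace Ω] (P : Measure Ω) [IsProbabilityMeasure P]
    -- `bit x m` is the `m`-th bit of the hash value of the key `x`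
    (bit : ℕ → ℕ → Ω → Bool)
    (hbit_meas : ∀ x m, Measurable (bit x m))
    (hbit_indep : iIndepFun (fun xm : ℕ × ℕ => bit xm.1 xm.2) P)
    (hbit_prob : ∀ x m, P.real {ω | bit x m ω = true} = p)
    -- `S n` is a stream, possibly with repetitions, of exactly the `n` distinct keys `0, …, n - 1`
    (S : ℕ → List ℕ) (hS : ∀ n, (S n).toFinset = Finset.range n)
    -- the final depth and the final cache size
    (D R : ℕ → Ω → ℕ)
    (hD : ∀ n ω, D n ω = AdaptiveSampling.finalDepth b (fun x m => bit x m ω) (S n))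
    (hR : ∀ n ω, R n ω = AdaptiveSampling.finalSize b (fun x m => bit x m ω) (S n))
    (Q L : ℝ) (hQ : Q = AdaptiveSampling.Q p) (hL : L = AdaptiveSampling.L p)
    (q : ℝ) (hq : q = 1 - p) :
    -- all moments exist, and the Fourier series converge absolutely
    (∀ n j : ℕ, Integrable (fun ω => ((D n ω : ℝ) - Real.logb Q n) ^ j) P) ∧
    (∀ j r : ℕ, 1 ≤ j → r ≤ b → ∀ x : ℝ,
      Summable fun l : {l : ℤ // l ≠ 0} => AdaptiveSampling.wTerm p b j r x (l : ℤ)) ∧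
    -- asymptotics of the moments, jointly with the value of `R` and in total
    (∃ γ : ℝ, 0 < γ ∧ ∀ j : ℕ, 1 ≤ j →
      (∀ r : ℕ, r ≤ b →
        (fun n : ℕ =>
          (((∫ ω in {ω | R n ω = r}, ((D n ω : ℝ) - Real.logb Q n) ^ j ∂P : ℝ) : ℂ) -
            (AdaptiveSampling.mTilde p b j r +
              AdaptiveSampling.wTilde p b j r (Real.logb Q n))))
          =O[atTop] fun n : ℕ => (n : ℝ) ^ (-γ)) ∧
      (fun n : ℕ =>
        (((∫ ω, ((D n ω : ℝ) - Real.logb Q n) ^ j ∂P : ℝ) : ℂ) -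
          ∑ r ∈ Finset.range (b + 1), (AdaptiveSampling.mTilde p b j r +
            AdaptiveSampling.wTilde p b j r (Real.logb Q n))))
        =O[atTop] fun n : ℕ => (n : ℝ) ^ (-γ)) ∧
    -- non-periodic part of the first moment
    (∀ k : ℕ, 1 ≤ k → k ≤ b →
      AdaptiveSampling.mTilde p b 1 k =
        -(Complex.digamma k) / ((L : ℂ) ^ 2 * k) +
        ∑ i ∈ Finset.range (b - k + 1),
          (Complex.digamma ((k : ℂ) + i) - L) * (q : ℂ) ^ k * (p : ℂ) ^ i *
              Complex.Gamma ((k : ℂ) + i) /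
            ((L : ℂ) ^ 2 * Complex.Gamma ((k : ℂ) + 1) * Complex.Gamma ((i : ℂ) + 1))) ∧
    (AdaptiveSampling.mTilde p b 1 0 =
      1 / 2 + (Real.eulerMascheroniConstant : ℂ) / L +
      ∑ i ∈ Finset.Icc 1 b,
        (Complex.digamma (i : ℂ) - L) * (p : ℂ) ^ i / ((i : ℂ) * (L : ℂ) ^ 2)) ∧
    -- non-periodic part of the second moment
    (∀ k : ℕ, 1 ≤ k → k ≤ b →
      AdaptiveSampling.mTilde p b 2 k =
        (AdaptiveSampling.trigamma k + Complex.digamma k ^ 2) / ((L : ℂ) ^ 3 * k) +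
        ∑ i ∈ Finset.range (b - k + 1),
          -((-2 * Complex.digamma ((k : ℂ) + i) * L + (L : ℂ) ^ 2 +
                AdaptiveSampling.trigamma ((k : ℂ) + i) + Complex.digamma ((k : ℂ) + i) ^ 2) *
              (q : ℂ) ^ k * (p : ℂ) ^ i * Complex.Gamma ((k : ℂ) + i) /
            ((L : ℂ) ^ 3 * Complex.Gamma ((k : ℂ) + 1) * Complex.Gamma ((i : ℂ) + 1)))) ∧
    (AdaptiveSampling.mTilde p b 2 0 =
      1 / 3 + (Real.eulerMascheroniConstant : ℂ) / L + (Real.pi : ℂ) ^ 2 / (6 * (L : ℂ) ^ 2) +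
        (Real.eulerMascheroniConstant : ℂ) ^ 2 / (L : ℂ) ^ 2 +
      ∑ i ∈ Finset.Icc 1 b,
        -((-2 * Complex.digamma (i : ℂ) * L + (L : ℂ) ^ 2 +
              AdaptiveSampling.trigamma (i : ℂ) + Complex.digamma (i : ℂ) ^ 2) * (p : ℂ) ^ i /
          ((i : ℂ) * (L : ℂ) ^ 3))) ∧
    -- periodic part of the first moment
    (∀ k : ℕ, 1 ≤ k → k ≤ b → ∀ x : ℝ,
      HasSum
        (fun l : {l : ℤ // l ≠ 0} =>
          (-(Complex.digamma ((k : ℂ) + AdaptiveSampling.χ p l) *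
                Complex.Gamma ((k : ℂ) + AdaptiveSampling.χ p l)) /
              ((L : ℂ) ^ 2 * Complex.Gamma ((k : ℂ) + 1)) +
            ∑ i ∈ Finset.range (b - k + 1),
              (Complex.digamma ((k : ℂ) + i + AdaptiveSampling.χ p l) - L) *
                  Complex.Gamma ((k : ℂ) + i + AdaptiveSampling.χ p l) *
                  (q : ℂ) ^ k * (p : ℂ) ^ i /
                ((L : ℂ) ^ 2 * Complex.Gamma ((k : ℂ) + 1) * Complex.Gamma ((i : ℂ) + 1))) *
          Complex.exp (-(2 * ((l : ℤ) : ℂ) * (Real.pi : ℂ) * Complex.I * (x : ℂ))))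
        (AdaptiveSampling.wTilde p b 1 k x)) ∧
    (∀ x : ℝ,
      HasSum
        (fun l : {l : ℤ // l ≠ 0} =>
          (-(Complex.digamma (AdaptiveSampling.χ p l) *
                Complex.Gamma (AdaptiveSampling.χ p l)) / (L : ℂ) ^ 2 +
            ∑ i ∈ Finset.range (b + 1),
              (Complex.digamma ((i : ℂ) + AdaptiveSampling.χ p l) - L) *
                  Complex.Gamma ((i : ℂ) + AdaptiveSampling.χ p l) * (p : ℂ) ^ i /
                ((L : ℂ) ^ 2 * Complex.Gamma ((i : ℂ) + 1))) *
          Complex.exp (-(2 * ((l : ℤ) : ℂ) * (Real.pi : ℂ) * Complex.I * (x : ℂ))))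
        (AdaptiveSampling.wTilde p b 1 0 x)) := by
  subst hQ hL hq
  have hn1 : ∀ᶠ n : ℕ in atTop, b < n := eventually_gt_atTop b
  -- All errors are `O(1/n)`, so the exponent `1` serves for every `j` and `r`.
  have hO : ∀ (F : ℕ → ℂ), (∃ C : ℝ, ∀ n : ℕ, b < n → ‖F n‖ ≤ C / n) →
      F =O[atTop] fun n : ℕ => (n : ℝ) ^ (-1 : ℝ) := by
    rintro F ⟨C, hC⟩
    refine IsBigO.of_bound C ?_
    filter_upwards [hn1] with n hn
    rw [Real.rpow_neg_one, norm_inv, Real.norm_natCast, ← div_eq_mul_inv]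
    exact hC n hn
  have hmom : ∀ j r : ℕ, r ≤ b → (fun n : ℕ =>
      (((∫ ω in {ω | R n ω = r},
          ((D n ω : ℝ) - Real.logb (AdaptiveSampling.Q p) n) ^ j ∂P : ℝ) : ℂ) -
        (AdaptiveSampling.mTilde p b j r +
          AdaptiveSampling.wTilde p b j r (Real.logb (AdaptiveSampling.Q p) n))))
      =O[atTop] fun n : ℕ => (n : ℝ) ^ (-1 : ℝ) := fun j r hr =>
    hO _ (AdaptiveSampling.exists_norm_moment_sub_le hp0 hp1 hbit_meas hbit_indep hbit_prob hS
      hD hR j hr)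
  refine ⟨fun n j => ?_, fun j r _ _ x => ?_, ⟨1, one_pos, fun j _ => ⟨hmom j, ?_⟩⟩,
    fun k hk _ => ?_, ?_, fun k hk _ => ?_, ?_, fun k hk _ x => ?_, fun x => ?_⟩
  · exact AdaptiveSampling.integrable_pow_depth_sub hp0 hp1 hbit_meas hbit_indep hbit_prob (hS n)
      (hD n) (hR n) _ j
  · exact (AdaptiveSampling.summable_wTerm hp0 hp1 b j r x).subtype _
  · refine (IsBigO.sum (s := Finset.range (b + 1)) fun r hr =>
      hmom j r (Nat.lt_succ_iff.1 (Finset.mem_range.1 hr))).congr_left fun n => ?_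
    rw [AdaptiveSampling.integral_pow_depth_sub_eq_sum hp0 hp1 hbit_meas hbit_indep hbit_prob
      (hS n) (hD n) (hR n), Complex.ofReal_sum, ← Finset.sum_sub_distrib,
      Finset.sum_apply]
  · exact AdaptiveSampling.mTilde_one hp0 hp1 b (by omega)
  · exact AdaptiveSampling.mTilde_one_zero hp0 hp1 b
  · exact AdaptiveSampling.mTilde_two hp0 hp1 b (by omega)
  · exact AdaptiveSampling.mTilde_two_zero hp0 hp1 b
  · refine ((AdaptiveSampling.summable_wTerm hp0 hp1 b 1 k x).subtype
      {l : ℤ | l ≠ 0}).hasSum.congr_fun fun l => ?_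
    exact (AdaptiveSampling.wTerm_one hp0 hp1 b k x l.2).symm
  · refine ((AdaptiveSampling.summable_wTerm hp0 hp1 b 1 0 x).subtype
      {l : ℤ | l ≠ 0}).hasSum.congr_fun fun l => ?_
    refine Eq.trans ?_ (AdaptiveSampling.wTerm_one hp0 hp1 b 0 x l.2).symm
    simp
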